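/- All graphs are finite and simple. For graphs $H$ and $F$, let $ex(n,\{H,F\})$ be the maximum number of edges of an $n$-vertex graph that contains neither $H$ nor $F$ as a (not necessarily induced) subgraph, and let $P_m$ be the path with $m$ vertices. A set $E'\subseteq E(F)$ is an edge control set of $F$ if every edge in $E(F)\setminus E'$ shares an end vertex with some edge in $E'$; the edge control number $\beta_1(F)$ is the minimum size of an edge control set of $F$. If $\beta_1(F)=1$, let $f(F)=\min\{d_F(u_1),d_F(u_2)\}$, where $\{u_1u_2\}$ is an edge control set of $F$ (when $\chi(F)\ge 3$ this value does not depend on the choice of $u_1u_2$). Let $v(F)$ be the number of vertices of $F$, and $N(F,K_3)$ the number of triangles in $F$. **Theorem.** Let $k\ge 2$ and let $H=P_{p_1}\cup\dots\cup P_{p_k}$ be the disjoint union of $k$ paths with $p_i\ge 3$ for all $i$ and $p_i\ne 3$ for at least one $i$ (that is, $H\ne kP_3$). Put $\ell_i=\lfloor p_i/2\rfloor$ and $\ell=\sum_{i=1}^k\ell_i$. Let $F$ be a graph without isolated vertices such that $\chi(F)\ge 3$ and $\beta_1(F)=1$. Then there is an $N$, depending only on $H$ and $F$, such that for all $n\ge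 N$ $$ex(n,\{H,F\})=(\ell-1)(n-\ell+1)+D_{F,H},$$ where $D_{F,H}=0$ if at least one of the following conditions holds, and $D_{F,H}=1$ otherwise: 1. some $p_i$ is even; 2. $v(F)\le \ell+1$; 3. $N(F,K_3)=1$ and $f(F)\le \ell$. -/

import Mathlib

namespace TuranLinearForest

/-- The disjoint union of the paths `P_{p 0}, …, P_{p (k-1)}`, where `P_m` is the path with `m`
vertices: the `i`-th component has the vertices `(i, 0), …, (i, p i - 1)`, and two vertices of the
same component are adjacent if and only if their positions are consecutive. -/
def linearForest {k : ℕ} (p : Fin k → ℕ) : SimpleGraph (Σ i : Fin k, Fin (p i)) where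
  Adj x y := x.1 = y.1 ∧ (x.2.val + 1 = y.2.val ∨ y.2.val + 1 = x.2.val)
  symm := ⟨fun _ _ h => ⟨h.1.symm, h.2.symm⟩⟩
  loopless := ⟨fun _ h => by have := h.2; omega⟩

open Classical in
/-- The Turán number `ex(n, {H, F})`: the maximum number of edges of a graph on `n` vertices
that contains neither `H` nor `F` as a (not necessarily induced) subgraph. -/
noncomputable def turanNumber {W V : Type*} (n : ℕ) (H : SimpleGraph W) (F : SimpleGraph V) : ℕ :=
  sSup {m : ℕ | ∃ G : SimpleGraph (Fin n), H.Free G ∧ F.Free G ∧ G.edgeFinset.card = m}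

/-- `E'` is an edge control set of `F`: a set of edges of `F` such that every other edge of `F`
shares an end vertex with an edge in `E'`. -/
def IsEdgeControlSet {V : Type*} (F : SimpleGraph V) (E' : Set (Sym2 V)) : Prop :=
  E' ⊆ F.edgeSet ∧ ∀ e ∈ F.edgeSet \ E', ∃ e' ∈ E', ∃ v : V, v ∈ e ∧ v ∈ e'

/-- The edge control number `β₁(F)`: the minimum size of an edge control set of `F`. -/
noncomputable def edgeControlNumber {V : Type*} (F : SimpleGraph V) : ℕ :=
  sInf {m : ℕ | ∃ E' : Finset (Sym2 V), IsEdgeControlSet F (E' : Set (Sym2 V)) ∧ E'.card = m}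

/-- `N(F, K₃)`: the number of triangles of `F`. -/
noncomputable def triangleCount {V : Type*} (F : SimpleGraph V) : ℕ :=
  (F.cliqueSet 3).ncard

/-- `f(F) = min {d(u₁), d(u₂)}`, where the single edge `u₁u₂` is an edge control set of `F`.
If there are several such edges, the smallest of these values is taken. (When `χ(F) ≥ 3`, all
such edges give the same value.) -/
noncomputable def minControlDegree {V : Type*} (F : SimpleGraph V) : ℕ :=
  sInf {m : ℕ | ∃ u₁ u₂ : V, IsEdgeControlSet F {s(u₁, u₂)} ∧
    m = min (F.neighborSet u₁).ncard (F.neighborSet u₂).ncard}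

/-- Property `R` of the pair consisting of `F` and of the linear forest with component orders
`p i`; here `∑ i, p i / 2` is the sum of the numbers `ℓ_i = ⌊p i / 2⌋`. -/
def PropertyR {V : Type*} (F : SimpleGraph V) {k : ℕ} (p : Fin k → ℕ) : Prop :=
  (∃ i, Even (p i)) ∨
  Nat.card V ≤ (∑ i, p i / 2) + 1 ∨
  (triangleCount F = 1 ∧ minControlDegree F ≤ ∑ i, p i / 2)

open Classical in
/-- `D_{F,H}`: it is `0` if the pair has property `R` and `1` otherwise. -/
noncomputable def correction {V : Type*} (F : SimpleGraph V) {k : ℕ} (p : Fin k → ℕ) : ℕ :=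
  if PropertyR F p then 0 else 1

end TuranLinearForest

namespace TuranLinearForest

open SimpleGraph

/-! Lower bound: take the complete bipartite graph with sides ℓ - 1 and n - ℓ + 1. Each path of H
needs ⌊p_i/2⌋ vertices of the small side, so H does not fit, and F does not because χ(F) ≥ 3. If all
p_i are odd, one extra edge in the large side leaves H excluded, and outside `PropertyR` it leaves F
excluded too (`linearForest_free_bipartitePlus`, `free_bipartitePlus`).

Upper bound, structure: `exists_common_neighbours` finds ℓ - 1 vertices A with a huge common
neighbourhood X in every large H-free graph with (ℓ-1)n - O(1) edges. Pass to a subset W in which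
every small set U meets at least (ℓ-1)|U| edges (`exists_robust_subset`). Paths are bounded since G
is H-free, so deleting a bounded set S from W leaves many small pieces with no outside neighbours in
W except in S (`exists_hasSmallPieces`). Each piece has a vertex with ℓ - 1 neighbours in S, or else
the deficit r is made up by a path on 2r + 1 vertices in the piece (an Erdős–Gallai argument) and a
path on r + 1 vertices starting at a chosen root. By pigeonhole many roots have the same
neighbourhood D in S. If |D| ≥ ℓ - 1, this gives A and X; otherwise the paths, linked through D,
form H.

Upper bound, counting: A is independent, because an edge with many common neighbours contains F
(`IsEdgeControlSet.isContained_of_book`). Zigzagging between A and X fails to build H by just one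
vertex of A, so a short path attached to A often completes it. Hence more than |A||U| edges meeting
a set U outside A force an edge of U joined to all of A, with every p_i odd
(`exists_edge_of_adjCount`); the surplus never exceeds one (`adjCount_compl_le`), and under
`PropertyR` such an edge yields a copy of H or F.

Counts use ordered pairs, so `adjCount G U U` is twice the number of edges in U. -/

/-- A list of distinct vertices, consecutive ones being adjacent. -/
def IsPathList {α : Type*} (G : SimpleGraph α) (l : List α) : Prop :=
  l.IsChain G.Adj ∧ l.Nodup

/-! ### Path lists and assembling linear forests from them -/

section PathLists

variable {α : Type*} {G : SimpleGraph α}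

theorem isPathList_singleton (x : α) : IsPathList G [x] := by
  simp [IsPathList]

theorem IsPathList.append {l₁ l₂ : List α} (h₁ : IsPathList G l₁) (h₂ : IsPathList G l₂)
    (hd : l₁.Disjoint l₂) (hadj : ∀ x ∈ l₁.getLast?, ∀ y ∈ l₂.head?, G.Adj x y) :
    IsPathList G (l₁ ++ l₂) :=
  ⟨h₁.1.append h₂.1 hadj, List.nodup_append'.2 ⟨h₁.2, h₂.2, hd⟩⟩

theorem IsPathList.reverse {l : List α} (h : IsPathList G l) : IsPathList G l.reverse := by
  refine ⟨?_, List.nodup_reverse.2 h.2⟩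
  rw [List.isChain_reverse]
  exact h.1.imp fun _ _ h => h.symm

theorem IsPathList.take {l : List α} (h : IsPathList G l) (n : ℕ) : IsPathList G (l.take n) :=
  ⟨h.1.take n, h.2.sublist (List.take_sublist n l)⟩

theorem IsPathList.drop {l : List α} (h : IsPathList G l) (n : ℕ) : IsPathList G (l.drop n) :=
  ⟨h.1.drop n, h.2.sublist (List.drop_sublist n l)⟩

/-- Pairwise disjoint path lists that are long enough contain the linear forest. -/
theorem linearForest_isContained_of_lists {k : ℕ} {p : Fin k → ℕ} (L : Fin k → List α)
    (hL : ∀ i, IsPathList G (L i)) (hlen : ∀ i, p i ≤ (L i).length)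
    (hdis : Pairwise fun i j => (L i).Disjoint (L j)) : linearForest p ⊑ G := by
  let f : (Σ i : Fin k, Fin (p i)) → α := fun x => (L x.1)[x.2.val]'(x.2.2.trans_le (hlen x.1))
  refine ⟨⟨⟨f, ?_⟩, ?_⟩⟩
  · rintro ⟨i, a⟩ ⟨j, b⟩ ⟨hij, hab⟩
    obtain rfl : i = j := hij
    have key : ∀ a b : Fin (p i), a.val + 1 = b.val → G.Adj (f ⟨i, a⟩) (f ⟨i, b⟩) := by
      intro a b h
      have := (hL i).1.getElem a.val (by have := b.2; have := hlen i; omega)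
      simp only [f]
      convert this using 2
      exact h.symm
    rcases hab with h | h
    · exact key _ _ h
    · exact (key _ _ h).symm
  · rintro ⟨i, a⟩ ⟨j, b⟩ hab
    have hab' : f ⟨i, a⟩ = f ⟨j, b⟩ := hab
    by_cases hij : i = j
    · subst hij
      have := (List.Nodup.getElem_inj_iff (hL i).2).1 hab'
      have : a = b := Fin.ext this
      rw [this]
    · have hj : f ⟨i, a⟩ ∈ L j := by
        rw [hab']
        exact List.getElem_mem _
      exact (hdis hij (List.getElem_mem _) hj).elim

/-- A long path contains the linear forest. -/
theorem linearForest_isContained_of_list {k : ℕ} {p : Fin k → ℕ} {l : List α}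
    (hl : IsPathList G l) (hlen : ∑ i, p i ≤ l.length) : linearForest p ⊑ G := by
  -- `finSigmaFinEquiv` lays the components end to end, so consecutive positions within a component
  -- stay consecutive in `l`.
  let f : (Σ i : Fin k, Fin (p i)) → α := fun x =>
    l[(finSigmaFinEquiv x).val]'((finSigmaFinEquiv x).2.trans_le hlen)
  refine ⟨⟨⟨f, ?_⟩, ?_⟩⟩
  · rintro ⟨i, a⟩ ⟨j, b⟩ ⟨hij, hab⟩
    obtain rfl : i = j := hij
    have key : ∀ a b : Fin (p i), a.val + 1 = b.val → G.Adj (f ⟨i, a⟩) (f ⟨i, b⟩) := by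
      intro a b h
      have ha := finSigmaFinEquiv_apply (⟨i, a⟩ : Σ i : Fin k, Fin (p i))
      have hb := finSigmaFinEquiv_apply (⟨i, b⟩ : Σ i : Fin k, Fin (p i))
      have hab : (finSigmaFinEquiv (⟨i, b⟩ : Σ i : Fin k, Fin (p i))).val
          = (finSigmaFinEquiv (⟨i, a⟩ : Σ i : Fin k, Fin (p i))).val + 1 := by
        rw [ha, hb]; simp only; omega
      have := hl.1.getElem (finSigmaFinEquiv (⟨i, a⟩ : Σ i : Fin k, Fin (p i))).val
        (by rw [← hab]; exact (finSigmaFinEquiv _).2.trans_le hlen)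
      simp only [f]
      convert this using 2
    rcases hab with h | h
    · exact key _ _ h
    · exact (key _ _ h).symm
  · intro x y hxy
    have := (List.Nodup.getElem_inj_iff hl.2).1 hxy
    exact finSigmaFinEquiv.injective (Fin.ext this)

/-- A path list can be prolonged by going back and forth between vertices `d t` and the first
vertices of the lists `T t`, and finally following the last of these lists. -/
theorem exists_prolonged_pathList (r : ℕ) : ∀ (c : ℕ) (h : List α) (d : Fin c → α)
    (T : Fin c → List α), IsPathList G h → (∀ t, IsPathList G (T t)) → Function.Injective d →
    (∀ t, d t ∉ h) → (∀ t t', d t ∉ T t') → (∀ t, h.Disjoint (T t)) →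
    (Pairwise fun t t' => (T t).Disjoint (T t')) → (∀ t, r + 1 ≤ (T t).length) →
    (∀ t, ∀ z ∈ h.getLast?, G.Adj z (d t)) → (∀ t t', ∀ z ∈ (T t').head?, G.Adj (d t) z) →
    ∃ L, IsPathList G L ∧ (h.length + if c = 0 then 0 else 2 * c + r) ≤ L.length ∧
      ∀ x ∈ L, x ∈ h ∨ (∃ t, x = d t) ∨ ∃ t, x ∈ T t := by
  intro c
  induction c with
  | zero =>
    intro h d T hh _ _ _ _ _ _ _ _ _
    exact ⟨h, hh, by simp, fun x hx => Or.inl hx⟩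
  | succ c ih =>
    intro h d T hh hT hd hdh hdT hhT hTT hlen hlast hhead
    obtain ⟨z, tl, hz⟩ : ∃ z tl, T 0 = z :: tl := by
      have := hlen 0
      match hT0 : T 0 with
      | [] => rw [hT0] at this; simp at this
      | z :: tl => exact ⟨z, tl, rfl⟩
    have hstep : ∀ l, IsPathList G l → (∀ x ∈ l, x ∈ T 0) → l.head? = some z →
        IsPathList G (h ++ d 0 :: l) := by
      intro l hl hsub hl0
      have h1 : IsPathList G (d 0 :: l) := by
        refine (isPathList_singleton (d 0)).append hl ?_ ?_
        · intro x hx hx'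
          rw [List.mem_singleton] at hx
          exact hdT 0 0 (hx ▸ hsub x hx')
        · intro x hx y hy
          obtain rfl : d 0 = x := by simpa using hx
          refine hhead 0 0 y ?_
          rw [hz]
          rw [hl0] at hy
          simpa using hy
      refine hh.append h1 ?_ ?_
      · intro x hx hx'
        rcases List.mem_cons.1 hx' with rfl | hx'
        · exact hdh 0 hx
        · exact hhT 0 hx (hsub x hx')
      · intro x hx y hy
        obtain rfl : d 0 = y := by simpa using hy
        exact hlast 0 x hx
    -- With one connector left, the path finishes along all of `T 0` and gains `r + 2` vertices.
    -- Otherwise it visits only the head `z` and gains two, with the next connector following `z`.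
    by_cases hc : c = 0
    · subst hc
      refine ⟨h ++ d 0 :: T 0, hstep _ (hT 0) (fun _ hx => hx) (by simp [hz]), ?_, ?_⟩
      · have := hlen 0
        simp
        omega
      · intro x hx
        rcases List.mem_append.1 hx with hx | hx
        · exact Or.inl hx
        rcases List.mem_cons.1 hx with hx | hx
        · exact Or.inr (Or.inl ⟨0, hx⟩)
        · exact Or.inr (Or.inr ⟨0, hx⟩)
    · have hzT : z ∈ T 0 := by simp [hz]
      have h' := hstep [z] (isPathList_singleton z) (by simpa using hzT) rfl
      obtain ⟨L, hL, hLlen, hLmem⟩ := ih (h ++ [d 0, z]) (fun t => d t.succ) (fun t => T t.succ)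
        h' (fun t => hT _) (fun a b hab => Fin.succ_injective _ (hd hab))
        (fun t ht => by
          rcases List.mem_append.1 ht with ht | ht
          · exact hdh _ ht
          · simp only [List.mem_cons, List.not_mem_nil, or_false] at ht
            rcases ht with ht | ht
            · exact Fin.succ_ne_zero _ (hd ht)
            · exact hdT t.succ 0 (ht ▸ hzT))
        (fun t t' => hdT _ _)
        (fun t x hx hx' => by
          rcases List.mem_append.1 hx with hx | hx
          · exact hhT _ hx hx'
          · simp only [List.mem_cons, List.not_mem_nil, or_false] at hx
            rcases hx with rfl | rfl
            · exact hdT 0 _ hx'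
            · exact hTT (Fin.succ_ne_zero t).symm hzT hx')
        (fun t t' htt' => hTT fun h => htt' (Fin.succ_injective _ h))
        (fun t => hlen _)
        (fun t x hx => by
          obtain rfl : z = x := by simpa using hx
          exact (hhead t.succ 0 z (by simp [hz])).symm)
        (fun t t' => hhead _ _)
      refine ⟨L, hL, ?_, ?_⟩
      · simp [hc] at hLlen ⊢
        omega
      · intro x hx
        rcases hLmem x hx with hx | ⟨t, hx⟩ | ⟨t, hx⟩
        · rcases List.mem_append.1 hx with hx | hx
          · exact Or.inl hx
          · simp only [List.mem_cons, List.not_mem_nil, or_false] at hx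
            rcases hx with rfl | rfl
            · exact Or.inr (Or.inl ⟨0, rfl⟩)
            · exact Or.inr (Or.inr ⟨0, hzT⟩)
        · exact Or.inr (Or.inl ⟨_, hx⟩)
        · exact Or.inr (Or.inr ⟨_, hx⟩)

/-- Building a linear forest from disjoint starting lists `h i`, a set `D` of connecting vertices
and disjoint lists `T j` whose first vertices are joined to all of `D`. -/
theorem linearForest_isContained_of_pieces {ι : Type*} [Fintype ι] {k : ℕ} {p : Fin k → ℕ}
    (r : ℕ) (c : Fin k → ℕ) (D : Finset α) (h : Fin k → List α) (T : ι → List α)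
    (hD : ∑ i, c i ≤ D.card) (hι : ∑ i, c i ≤ Fintype.card ι)
    (hh : ∀ i, IsPathList G (h i)) (hT : ∀ j, IsPathList G (T j))
    (hhh : Pairwise fun i i' => (h i).Disjoint (h i'))
    (hTT : Pairwise fun j j' => (T j).Disjoint (T j')) (hhT : ∀ i j, (h i).Disjoint (T j))
    (hDh : ∀ d ∈ D, ∀ i, d ∉ h i) (hDT : ∀ d ∈ D, ∀ j, d ∉ T j)
    (hlen : ∀ j, r + 1 ≤ (T j).length)
    (hlast : ∀ i, 0 < c i → ∀ d ∈ D, ∀ z ∈ (h i).getLast?, G.Adj z d)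
    (hhead : ∀ j, ∀ d ∈ D, ∀ z ∈ (T j).head?, G.Adj d z)
    (hp : ∀ i, p i ≤ (h i).length + if c i = 0 then 0 else 2 * c i + r) :
    linearForest p ⊑ G := by
  have hcard : Fintype.card (Σ i : Fin k, Fin (c i)) = ∑ i, c i := by simp
  obtain ⟨eD⟩ : Nonempty ((Σ i : Fin k, Fin (c i)) ↪ D) :=
    Function.Embedding.nonempty_of_card_le (by rw [hcard]; simpa using hD)
  obtain ⟨eT⟩ : Nonempty ((Σ i : Fin k, Fin (c i)) ↪ ι) :=
    Function.Embedding.nonempty_of_card_le (by rw [hcard]; exact hι)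
  have hex : ∀ i, ∃ L, IsPathList G L ∧
      ((h i).length + if c i = 0 then 0 else 2 * c i + r) ≤ L.length ∧
      ∀ x ∈ L, x ∈ h i ∨ (∃ t, x = (eD ⟨i, t⟩ : α)) ∨ ∃ t, x ∈ T (eT ⟨i, t⟩) := by
    intro i
    refine exists_prolonged_pathList r (c i) (h i) (fun t => (eD ⟨i, t⟩ : α))
      (fun t => T (eT ⟨i, t⟩)) (hh i) (fun t => hT _) ?_ (fun t => hDh _ (eD _).2 i)
      (fun t t' => hDT _ (eD _).2 _) (fun t => hhT _ _) ?_ (fun t => hlen _) ?_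
      (fun t t' => hhead _ _ (eD _).2)
    · intro a b hab
      have := eD.injective (Subtype.ext hab)
      simpa using this
    · intro t t' htt'
      refine hTT fun h => htt' ?_
      simpa using eT.injective h
    · intro t
      exact hlast i (Fin.pos t) _ (eD _).2
  choose L hL hLlen hLmem using hex
  refine linearForest_isContained_of_lists L hL (fun i => (hp i).trans (hLlen i)) ?_
  intro i j hij x hxi hxj
  rcases hLmem i x hxi with hi | ⟨t, hi⟩ | ⟨t, hi⟩ <;>
    rcases hLmem j x hxj with hj | ⟨t', hj⟩ | ⟨t', hj⟩
  · exact hhh hij hi hj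
  · exact hDh _ (eD ⟨j, t'⟩).2 i (hj ▸ hi)
  · exact hhT _ _ hi hj
  · exact hDh _ (eD ⟨i, t⟩).2 j (hi ▸ hj)
  · have := eD.injective (Subtype.ext (hi.symm.trans hj))
    exact hij (congrArg Sigma.fst this)
  · exact hDT _ (eD ⟨i, t⟩).2 _ (hi ▸ hj)
  · exact hhT _ _ hj hi
  · exact hDT _ (eD ⟨j, t'⟩).2 _ (hj ▸ hi)
  · refine hTT (fun h => hij ?_) hi hj
    exact congrArg Sigma.fst (eT.injective h)

end PathLists

/-! ### Counting ordered adjacent pairs -/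

section AdjCount

variable {α : Type*} (G : SimpleGraph α)

open Classical in
/-- The number of pairs of adjacent vertices, the first one in `U` and the second one in `W`. -/
noncomputable def adjCount (U W : Finset α) : ℤ :=
  ∑ u ∈ U, ∑ v ∈ W, if G.Adj u v then 1 else 0

open Classical in
theorem adjCount_comm (U W : Finset α) : adjCount G U W = adjCount G W U := by
  unfold adjCount
  rw [Finset.sum_comm]
  exact Finset.sum_congr rfl fun _ _ => Finset.sum_congr rfl fun _ _ =>
    if_congr (G.adj_comm _ _) rfl rfl

theorem adjCount_nonneg (U W : Finset α) : 0 ≤ adjCount G U W :=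
  Finset.sum_nonneg fun _ _ => Finset.sum_nonneg fun _ _ => by split_ifs <;> simp

open Classical in
theorem adjCount_union_left {U₁ U₂ : Finset α} (h : Disjoint U₁ U₂) (W : Finset α) :
    adjCount G (U₁ ∪ U₂) W = adjCount G U₁ W + adjCount G U₂ W :=
  Finset.sum_union h

open Classical in
theorem adjCount_union_right (U : Finset α) {W₁ W₂ : Finset α} (h : Disjoint W₁ W₂) :
    adjCount G U (W₁ ∪ W₂) = adjCount G U W₁ + adjCount G U W₂ := by
  rw [adjCount_comm, adjCount_union_left G h, adjCount_comm, adjCount_comm G W₂]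

open Classical in
theorem adjCount_union_self {U W : Finset α} (h : Disjoint U W) :
    adjCount G (U ∪ W) (U ∪ W) = adjCount G U U + 2 * adjCount G U W + adjCount G W W := by
  rw [adjCount_union_left G h, adjCount_union_right G _ h, adjCount_union_right G _ h,
    adjCount_comm G W U]
  ring

theorem adjCount_eq_zero {U W : Finset α} (h : ∀ u ∈ U, ∀ v ∈ W, ¬ G.Adj u v) :
    adjCount G U W = 0 :=
  Finset.sum_eq_zero fun u hu => Finset.sum_eq_zero fun v hv => if_neg (h u hu v hv)

theorem adjCount_le_card_mul_card (U W : Finset α) :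
    adjCount G U W ≤ U.card * W.card := by
  unfold adjCount
  calc _ ≤ ∑ u ∈ U, ∑ v ∈ W, (1 : ℤ) := by
        refine Finset.sum_le_sum fun _ _ => Finset.sum_le_sum fun _ _ => ?_
        split_ifs <;> simp
    _ = _ := by simp

theorem adjCount_eq_card_mul_card {U W : Finset α} (h : ∀ u ∈ U, ∀ v ∈ W, G.Adj u v) :
    adjCount G U W = U.card * W.card := by
  unfold adjCount
  calc _ = ∑ u ∈ U, ∑ v ∈ W, (1 : ℤ) :=
        Finset.sum_congr rfl fun u hu => Finset.sum_congr rfl fun v hv => if_pos (h u hu v hv)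
    _ = _ := by simp

open Classical in
theorem adjCount_singleton_left (u : α) (W : Finset α) :
    adjCount G {u} W = (W.filter (G.Adj u)).card := by
  simp [adjCount]

theorem adjCount_eq_sum (U W : Finset α) : adjCount G U W = ∑ u ∈ U, adjCount G {u} W := by
  simp [adjCount]

theorem adjCount_singleton_self (u : α) : adjCount G {u} {u} = 0 := by
  simp [adjCount]

open Classical in
theorem adjCount_self_le (U : Finset α) : adjCount G U U ≤ U.card * (U.card - 1) := by
  rw [adjCount_eq_sum]
  calc _ ≤ ∑ u ∈ U, ((U.card : ℤ) - 1) := by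
        refine Finset.sum_le_sum fun u hu => ?_
        rw [adjCount_singleton_left]
        have h1 : U.filter (G.Adj u) ⊆ U.erase u := by
          intro v hv
          rw [Finset.mem_filter] at hv
          exact Finset.mem_erase.2 ⟨hv.2.ne', hv.1⟩
        have h2 := Finset.card_le_card h1
        have h3 := Finset.card_erase_add_one hu
        omega
    _ = _ := by simp [mul_sub]

open Classical in
theorem adjCount_erase_self {U : Finset α} {u : α} (hu : u ∈ U) :
    adjCount G U U = adjCount G (U.erase u) (U.erase u) + 2 * adjCount G {u} U := by
  have hd : Disjoint {u} (U.erase u) := by simp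
  have hU : {u} ∪ U.erase u = U := by
    rw [← Finset.insert_eq, Finset.insert_erase hu]
  have h1 := adjCount_union_self G hd
  have h2 := adjCount_union_right G {u} hd
  rw [hU] at h1 h2
  rw [adjCount_singleton_self] at h1 h2
  linarith

open Classical in
theorem adjCount_sdiff_self {U W : Finset α} (h : U ⊆ W) :
    adjCount G W W = adjCount G U U + 2 * adjCount G U (W \ U) + adjCount G (W \ U) (W \ U) := by
  have := adjCount_union_self G (Finset.disjoint_sdiff (s := U) (t := W))
  rwa [Finset.union_sdiff_of_subset h] at this

end AdjCount

/-! ### Long paths from degree conditions -/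

section LongPaths

variable {α : Type*} {G : SimpleGraph α}

/-- A path list whose end vertices have crossing neighbours closes up to a cycle. -/
theorem IsPathList.exists_cycle_of_crossing {l : List α} (hl : IsPathList G l) {i : ℕ}
    (hi : i + 1 < l.length) (h0 : G.Adj (l[0]'(by omega)) l[i + 1])
    (h1 : G.Adj (l[l.length - 1]'(by omega)) l[i]) :
    ∃ c : List α, IsPathList G c ∧ c.Perm l ∧ ∀ x ∈ c.head?, ∀ y ∈ c.getLast?, G.Adj x y := by
  have hne : l.take (i + 1) ≠ [] := by
    intro h
    have := congrArg List.length h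
    rw [List.length_take, List.length_nil] at this
    omega
  have hne' : l.drop (i + 1) ≠ [] := by
    intro h
    have := congrArg List.length h
    simp at this
    omega
  -- Follow `l` up to `l[i]`, jump to its last vertex and run back to `l[i + 1]`, which is adjacent
  -- to the start.
  refine ⟨l.take (i + 1) ++ (l.drop (i + 1)).reverse, (hl.take _).append (hl.drop _).reverse ?_ ?_,
    ?_, ?_⟩
  · have := hl.2
    rw [← List.take_append_drop (i + 1) l, List.nodup_append'] at this
    intro x hx hx'
    exact this.2.2 hx (List.mem_reverse.1 hx')
  · intro x hx y hy
    have e1 : (l.take (i + 1)).getLast? = some l[i] := by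
      rw [List.getLast?_eq_getElem?, List.length_take, min_eq_left (by omega),
        List.getElem?_take_of_lt (by omega), Nat.add_sub_cancel, List.getElem?_eq_getElem]
    have e2 : (l.drop (i + 1)).reverse.head? = some (l[l.length - 1]'(by omega)) := by
      rw [List.head?_reverse, List.getLast?_drop, if_neg (by omega), List.getLast?_eq_getElem?,
        List.getElem?_eq_getElem]
    rw [e1] at hx
    rw [e2] at hy
    simp only [Option.mem_def, Option.some.injEq] at hx hy
    subst hx hy
    exact h1.symm
  · refine ((List.reverse_perm _).append_left _).trans ?_
    rw [List.take_append_drop]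
  · intro x hx y hy
    have e1 : (l.take (i + 1) ++ (l.drop (i + 1)).reverse).head? = some (l[0]'(by omega)) := by
      rw [List.head?_append_of_ne_nil _ hne, List.head?_take, if_neg (by omega),
        List.head?_eq_getElem?, List.getElem?_eq_getElem]
    have e2 : (l.take (i + 1) ++ (l.drop (i + 1)).reverse).getLast? = some l[i + 1] := by
      rw [List.getLast?_append_of_ne_nil _ (by simpa using hne'), List.getLast?_reverse,
        List.head?_drop, List.getElem?_eq_getElem hi]
    rw [e1] at hx
    rw [e2] at hy
    simp only [Option.mem_def, Option.some.injEq] at hx hy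
    subst hx hy
    exact h0

/-- A cycle with a neighbour outside of it contains a path through all its vertices and that
neighbour. -/
theorem IsPathList.exists_cons_of_cycle {c : List α} (hc : IsPathList G c)
    (hcyc : ∀ x ∈ c.head?, ∀ y ∈ c.getLast?, G.Adj x y) {z u : α} (hz : z ∉ c) (hu : u ∈ c)
    (hzu : G.Adj z u) : ∃ l : List α, IsPathList G l ∧ l.Perm (z :: c) := by
  obtain ⟨s, t, rfl⟩ := List.append_of_mem hu
  have hperm : (u :: t ++ s).Perm (s ++ u :: t) := List.perm_append_comm
  have hut : IsPathList G (u :: t ++ s) := by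
    have hnd := hperm.nodup_iff.2 hc.2
    refine ⟨List.isChain_append.2 ⟨(List.isChain_append.1 hc.1).2.1,
      (List.isChain_append.1 hc.1).1, ?_⟩, hnd⟩
    intro x hx y hy
    refine (hcyc y ?_ x ?_).symm
    · cases s with
      | nil => simp at hy
      | cons a s => simpa using hy
    · rw [List.getLast?_append_of_ne_nil _ (by simp)]
      exact hx
  refine ⟨z :: (u :: t ++ s), ?_, hperm.cons z⟩
  refine (isPathList_singleton z).append hut ?_ ?_
  · intro x hx hx'
    rw [List.mem_singleton] at hx
    exact hz (hx ▸ hperm.mem_iff.1 hx')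
  · intro x hx y hy
    have e1 : z = x := by simpa using hx
    have e2 : u = y := by simpa using hy
    rw [← e1, ← e2]
    exact hzu

open Classical in
/-- If both end vertices of a short path have many neighbours on it, then there is a cycle through
all its vertices. -/
theorem IsPathList.exists_cycle_of_card {l : List α} (hl : IsPathList G l) {r : ℕ}
    (hr : l.length ≤ 2 * r) (hne : l ≠ []) {A B : Finset α}
    (hA : ∀ x ∈ A, x ∈ l ∧ G.Adj (l.head hne) x) (hB : ∀ x ∈ B, x ∈ l ∧ G.Adj (l.getLast hne) x)
    (hAr : r + 1 ≤ A.card) (hBr : r + 1 ≤ B.card) :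
    ∃ c : List α, IsPathList G c ∧ c.Perm l ∧ ∀ x ∈ c.head?, ∀ y ∈ c.getLast?, G.Adj x y := by
  have hpos : 0 < l.length := List.length_pos_iff.2 hne
  set v := l.head hne with hv
  -- `I` holds the predecessors of positions adjacent to the first vertex, `J` the positions
  -- adjacent to the last. Each has at least `r + 1` elements among at most `2 * r - 1` positions,
  -- so they meet and give a crossing.
  let I := (Finset.range (l.length - 1)).filter fun i => G.Adj v (l.getD (i + 1) v)
  let J := (Finset.range (l.length - 1)).filter fun i => G.Adj (l.getLast hne) (l.getD i v)
  have hv0 : v = l[0] := by rw [hv, List.head_eq_getElem]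
  have hw0 : l.getLast hne = l[l.length - 1] := List.getLast_eq_getElem hne
  have hI : A ⊆ I.image fun i => l.getD (i + 1) v := by
    intro x hx
    obtain ⟨hxl, hxa⟩ := hA x hx
    obtain ⟨i, hi, rfl⟩ := List.getElem_of_mem hxl
    have hi0 : i ≠ 0 := by
      rintro rfl
      rw [hv0] at hxa
      exact hxa.ne rfl
    have e : l.getD (i - 1 + 1) v = l[i] := by
      rw [Nat.sub_add_cancel (by omega), List.getD_eq_getElem _ _ hi]
    refine Finset.mem_image.2 ⟨i - 1, Finset.mem_filter.2 ⟨Finset.mem_range.2 (by omega), ?_⟩, e⟩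
    rw [e]
    exact hxa
  have hJ : B ⊆ J.image fun i => l.getD i v := by
    intro x hx
    obtain ⟨hxl, hxa⟩ := hB x hx
    obtain ⟨i, hi, rfl⟩ := List.getElem_of_mem hxl
    have hi0 : i ≠ l.length - 1 := by
      rintro rfl
      rw [hw0] at hxa
      exact hxa.ne rfl
    have e : l.getD i v = l[i] := List.getD_eq_getElem _ _ hi
    refine Finset.mem_image.2 ⟨i, Finset.mem_filter.2 ⟨Finset.mem_range.2 (by omega), ?_⟩, e⟩
    rw [e]
    exact hxa
  have hIc := (Finset.card_le_card hI).trans Finset.card_image_le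
  have hJc := (Finset.card_le_card hJ).trans Finset.card_image_le
  have hIJ : ¬ Disjoint I J := by
    intro hd
    have h1 : I ∪ J ⊆ Finset.range (l.length - 1) :=
      Finset.union_subset (Finset.filter_subset _ _) (Finset.filter_subset _ _)
    have h2 := Finset.card_le_card h1
    rw [Finset.card_union_of_disjoint hd, Finset.card_range] at h2
    omega
  obtain ⟨i, hiI, hiJ⟩ := Finset.not_disjoint_iff.1 hIJ
  rw [Finset.mem_filter, Finset.mem_range] at hiI hiJ
  have hi : i + 1 < l.length := by omega
  refine hl.exists_cycle_of_crossing hi ?_ ?_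
  · have := hiI.2
    rwa [List.getD_eq_getElem _ _ hi, hv0] at this
  · have := hiJ.2
    rwa [List.getD_eq_getElem _ _ (by omega : i < l.length), hw0] at this

-- Pósa-style extension. If neither end of a path with at most `2 * r` vertices has a neighbour off
-- the path, both ends have `r + 1` neighbours on it and the path closes to a cycle. By connectivity
-- some edge leaves the cycle, and opening the cycle there gives a longer path.
open Classical in
theorem exists_pathList_of_min_degree {U : Finset α} {r : ℕ} (hU : U.Nonempty)
    (hdeg : ∀ u ∈ U, r + 1 ≤ (U.filter (G.Adj u)).card) (hcard : 2 * r + 1 ≤ U.card)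
    (hconn : ∀ U' ⊆ U, U'.Nonempty → U' ≠ U → ∃ u ∈ U', ∃ v ∈ U \ U', G.Adj u v) :
    ∀ n ≤ 2 * r + 1, ∃ l, IsPathList G l ∧ (∀ x ∈ l, x ∈ U) ∧ l ≠ [] ∧ n ≤ l.length := by
  intro n
  induction n with
  | zero =>
    intro _
    obtain ⟨x, hx⟩ := hU
    exact ⟨[x], isPathList_singleton x, by simpa using hx, by simp, by simp⟩
  | succ n ih =>
    intro hn
    obtain ⟨l, hl, hlU, hne, hlen⟩ := ih (by omega)
    rcases hlen.lt_or_eq with hlt | heq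
    · exact ⟨l, hl, hlU, hne, hlt⟩
    by_cases hA : ∃ z ∈ U, z ∉ l ∧ G.Adj (l.head hne) z
    · obtain ⟨z, hzU, hzl, hz⟩ := hA
      refine ⟨z :: l, (isPathList_singleton z).append hl (by simpa using hzl) ?_, ?_, by simp,
        by simp; omega⟩
      · intro x hx y hy
        rw [List.head?_eq_some_head hne] at hy
        have e1 : z = x := by simpa using hx
        have e2 : l.head hne = y := by simpa using hy
        rw [← e1, ← e2]
        exact hz.symm
      · intro x hx
        rcases List.mem_cons.1 hx with rfl | hx
        · exact hzU
        · exact hlU x hx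
    by_cases hB : ∃ z ∈ U, z ∉ l ∧ G.Adj (l.getLast hne) z
    · obtain ⟨z, hzU, hzl, hz⟩ := hB
      refine ⟨l ++ [z], hl.append (isPathList_singleton z) (by simpa using hzl) ?_, ?_, by simp,
        by simp; omega⟩
      · intro x hx y hy
        rw [List.getLast?_eq_some_getLast hne] at hx
        have e1 : l.getLast hne = x := by simpa using hx
        have e2 : z = y := by simpa using hy
        rw [← e1, ← e2]
        exact hz
      · intro x hx
        rcases List.mem_append.1 hx with hx | hx
        · exact hlU x hx
        · rw [List.mem_singleton.1 hx]
          exact hzU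
    push Not at hA hB
    obtain ⟨c, hc, hcl, hcyc⟩ := hl.exists_cycle_of_card (r := r) (by omega) hne
      (A := U.filter (G.Adj (l.head hne))) (B := U.filter (G.Adj (l.getLast hne)))
      (fun x hx => by
        rw [Finset.mem_filter] at hx
        refine ⟨?_, hx.2⟩
        by_contra hxl
        exact hA x hx.1 hxl hx.2)
      (fun x hx => by
        rw [Finset.mem_filter] at hx
        refine ⟨?_, hx.2⟩
        by_contra hxl
        exact hB x hx.1 hxl hx.2)
      (hdeg _ (hlU _ (List.head_mem hne))) (hdeg _ (hlU _ (List.getLast_mem hne)))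
    obtain ⟨u, hu, z, hz, huz⟩ := hconn l.toFinset
      (fun x hx => hlU x (List.mem_toFinset.1 hx))
      ⟨l.head hne, List.mem_toFinset.2 (List.head_mem hne)⟩
      (fun h => by
        have h1 := List.toFinset_card_le l
        rw [h] at h1
        omega)
    rw [Finset.mem_sdiff, List.mem_toFinset] at hz
    obtain ⟨l', hl', hperm⟩ := hc.exists_cons_of_cycle hcyc (fun h => hz.2 (hcl.mem_iff.1 h))
      (hcl.mem_iff.2 (List.mem_toFinset.1 hu)) huz.symm
    have hlen' := hperm.length_eq
    rw [List.length_cons, hcl.length_eq] at hlen'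
    refine ⟨l', hl', ?_, ?_, by omega⟩
    · intro x hx
      rcases List.mem_cons.1 (hperm.mem_iff.1 hx) with rfl | hx
      · exact hz.1
      · exact hlU x (hcl.mem_iff.1 hx)
    · rintro rfl
      simp at hlen'

open Classical in
/-- A form of the Erdős–Gallai theorem: a graph with average degree at least `2 * r` contains a
path with `2 * r + 1` vertices. -/
theorem exists_pathList_of_adjCount (r : ℕ) (U : Finset α) (hU : U.Nonempty)
    (h : 2 * (r : ℤ) * U.card ≤ adjCount G U U) :
    ∃ l, IsPathList G l ∧ (∀ x ∈ l, x ∈ U) ∧ 2 * r + 1 ≤ l.length := by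
  induction U using Finset.strongInduction with
  | H U ih =>
  by_cases hdeg : ∀ u ∈ U, r + 1 ≤ (U.filter (G.Adj u)).card
  · by_cases hconn : ∀ U' ⊆ U, U'.Nonempty → U' ≠ U → ∃ u ∈ U', ∃ v ∈ U \ U', G.Adj u v
    · have hcard : 2 * r + 1 ≤ U.card := by
        have h1 := h.trans (adjCount_self_le G U)
        have h2 : (0 : ℤ) < U.card := by exact_mod_cast hU.card_pos
        have h3 : 2 * (r : ℤ) ≤ U.card - 1 := by
          rw [mul_comm] at h1
          exact le_of_mul_le_mul_left h1 h2
        omega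
      obtain ⟨l, hl, hlU, -, hlen⟩ := exists_pathList_of_min_degree hU hdeg hcard hconn _ le_rfl
      exact ⟨l, hl, hlU, hlen⟩
    · push Not at hconn
      obtain ⟨U', hU', hne, hneU, hno⟩ := hconn
      have hsplit := adjCount_sdiff_self G hU'
      rw [adjCount_eq_zero G hno] at hsplit
      have hc : (U \ U').card + U'.card = U.card := Finset.card_sdiff_add_card_eq_card hU'
      have hss : U' ⊂ U := lt_of_le_of_ne hU' hneU
      have hne' : (U \ U').Nonempty := Finset.sdiff_nonempty.2 hss.2
      -- No edge joins `U'` to the rest, so the counts add and one of the two sides keeps average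
      -- degree at least `2 * r`.
      by_cases h1 : 2 * (r : ℤ) * U'.card ≤ adjCount G U' U'
      · obtain ⟨l, hl, hlU, hlen⟩ := ih U' hss hne h1
        exact ⟨l, hl, fun x hx => hU' (hlU x hx), hlen⟩
      · have h2 : 2 * (r : ℤ) * (U \ U').card ≤ adjCount G (U \ U') (U \ U') := by
          have : (U.card : ℤ) = (U \ U').card + U'.card := by exact_mod_cast hc.symm
          rw [this] at h
          nlinarith
        obtain ⟨l, hl, hlU, hlen⟩ := ih (U \ U') (Finset.sdiff_ssubset hU' hne) hne' h2
        exact ⟨l, hl, fun x hx => Finset.sdiff_subset (hlU x hx), hlen⟩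
  · push Not at hdeg
    obtain ⟨u, hu, hdu⟩ := hdeg
    rcases Nat.eq_zero_or_pos r with rfl | hr
    · exact ⟨[u], isPathList_singleton u, by simpa using hu, by simp⟩
    have h1 := adjCount_erase_self G hu
    rw [adjCount_singleton_left] at h1
    have h2 := Finset.card_erase_add_one hu
    -- A vertex of degree at most `r` accounts for at most `2 * r` ordered pairs, so deleting it
    -- preserves the hypothesis.
    have h3 : 2 * (r : ℤ) * (U.erase u).card ≤ adjCount G (U.erase u) (U.erase u) := by
      have : (U.card : ℤ) = (U.erase u).card + 1 := by exact_mod_cast h2.symm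
      rw [this] at h
      have : (((U.filter (G.Adj u)).card : ℕ) : ℤ) ≤ r := by exact_mod_cast Nat.lt_succ_iff.1 hdu
      nlinarith
    have hne : (U.erase u).Nonempty := by
      rw [Finset.nonempty_iff_ne_empty]
      intro he
      have hUu : U = {u} := by
        rw [← Finset.insert_erase hu, he]
        simp
      rw [hUu, adjCount_singleton_self] at h
      simp at h
      omega
    obtain ⟨l, hl, hlU, hlen⟩ := ih _ (Finset.erase_ssubset hu) hne h3
    exact ⟨l, hl, fun x hx => Finset.mem_of_mem_erase (hlU x hx), hlen⟩

open Classical in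
/-- If all degrees in `U` are at least `r`, then every vertex of `U` starts a path with `r + 1`
vertices. -/
theorem exists_pathList_from {U : Finset α} {r : ℕ} {v : α} (hv : v ∈ U)
    (hdeg : ∀ u ∈ U, r ≤ (U.filter (G.Adj u)).card) :
    ∃ l, IsPathList G l ∧ (∀ x ∈ l, x ∈ U) ∧ l.head? = some v ∧ l.length = r + 1 := by
  suffices h : ∀ n ≤ r, ∃ l, IsPathList G l ∧ (∀ x ∈ l, x ∈ U) ∧ l.getLast? = some v ∧
      l.length = n + 1 by
    obtain ⟨l, hl, hlU, hlv, hlen⟩ := h r le_rfl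
    exact ⟨l.reverse, hl.reverse, by simpa using hlU, by simpa using hlv, by simpa using hlen⟩
  intro n
  induction n with
  | zero => exact fun _ => ⟨[v], isPathList_singleton v, by simpa using hv, by simp, by simp⟩
  | succ n ih =>
    intro hn
    obtain ⟨l, hl, hlU, hlv, hlen⟩ := ih (by omega)
    obtain ⟨a, t, rfl⟩ : ∃ a t, l = a :: t := by
      cases l with
      | nil => simp at hlen
      | cons a t => exact ⟨a, t, rfl⟩
    have ha : a ∈ U := hlU a (by simp)
    obtain ⟨z, hz, hzl⟩ : ∃ z ∈ U.filter (G.Adj a), z ∉ t.toFinset := by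
      by_contra! hc
      have h1 := Finset.card_le_card (fun z hz => hc z hz : U.filter (G.Adj a) ⊆ t.toFinset)
      have h2 := List.toFinset_card_le t
      have h3 := hdeg a ha
      simp at hlen
      omega
    rw [Finset.mem_filter] at hz
    rw [List.mem_toFinset] at hzl
    refine ⟨z :: a :: t, (isPathList_singleton z).append hl ?_ ?_, ?_, ?_, by simpa using hlen⟩
    · intro x hx hx'
      rw [List.mem_singleton] at hx
      subst hx
      rcases List.mem_cons.1 hx' with rfl | hx'
      · exact hz.2.ne rfl
      · exact hzl hx'
    · intro x hx y hy
      have e1 : z = x := by simpa using hx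
      have e2 : a = y := by simpa using hy
      rw [← e1, ← e2]
      exact hz.2.symm
    · intro x hx
      rcases List.mem_cons.1 hx with rfl | hx
      · exact hz.1
      · exact hlU x hx
    · rw [List.getLast?_cons_cons]
      exact hlv

end LongPaths

/-! ### Components of induced subgraphs and splitting into small pieces -/

section Components

variable {α : Type*} (G : SimpleGraph α)

/-- Adjacency inside of `W`. -/
def AdjIn (W : Finset α) (a b : α) : Prop := G.Adj a b ∧ a ∈ W ∧ b ∈ W

open Classical in
/-- The vertex set of the connected component of `y` in the subgraph induced by `W`. -/
noncomputable def compIn (W : Finset α) (y : α) : Finset α :=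
  W.filter (Relation.ReflTransGen (AdjIn G W) y)

variable {G}

theorem reflTransGen_adjIn_symm {W : Finset α} {a b : α}
    (h : Relation.ReflTransGen (AdjIn G W) a b) : Relation.ReflTransGen (AdjIn G W) b a := by
  refine (?_ : Std.Symm (Relation.ReflTransGen (AdjIn G W))).symm _ _ h
  have : Std.Symm (AdjIn G W) := ⟨fun _ _ h => ⟨h.1.symm, h.2.2, h.2.1⟩⟩
  infer_instance

theorem mem_compIn {W : Finset α} {y z : α} :
    z ∈ compIn G W y ↔ z ∈ W ∧ Relation.ReflTransGen (AdjIn G W) y z := by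
  simp [compIn]

theorem compIn_subset (W : Finset α) (y : α) : compIn G W y ⊆ W :=
  fun _ h => (mem_compIn.1 h).1

theorem mem_compIn_self {W : Finset α} {y : α} (hy : y ∈ W) : y ∈ compIn G W y :=
  mem_compIn.2 ⟨hy, .refl⟩

theorem mem_compIn_of_adj {W : Finset α} {y z z' : α} (hz : z ∈ compIn G W y) (hz' : z' ∈ W)
    (h : G.Adj z z') : z' ∈ compIn G W y :=
  mem_compIn.2 ⟨hz', (mem_compIn.1 hz).2.tail ⟨h, (mem_compIn.1 hz).1, hz'⟩⟩

theorem compIn_eq_of_mem {W : Finset α} {y z : α} (hz : z ∈ compIn G W y) :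
    compIn G W y = compIn G W z := by
  have h := (mem_compIn.1 hz).2
  ext x
  rw [mem_compIn, mem_compIn]
  exact and_congr_right fun _ => ⟨(reflTransGen_adjIn_symm h).trans, h.trans⟩

/-- A walk in `W` from `y` never leaves the component of `y`. This lets the recursion below restart
inside a component. -/
theorem reflTransGen_adjIn_compIn {W : Finset α} {y z : α} (hz : z ∈ compIn G W y) :
    Relation.ReflTransGen (AdjIn G (compIn G W y)) y z := by
  have h := (mem_compIn.1 hz).2
  clear hz
  induction h with
  | refl => exact .refl
  | @tail b c hb hbc ih =>
    have hbm : b ∈ compIn G W y := mem_compIn.2 ⟨hbc.2.1, hb⟩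
    exact ih.tail ⟨hbc.1, hbm, mem_compIn_of_adj hbm hbc.2.2 hbc.1⟩

open Classical in
/-- Deleting the root `x` of a connected set, every vertex is still reachable from a neighbour
of `x`. -/
theorem exists_adj_reflTransGen_erase {W : Finset α} {x z : α}
    (h : Relation.ReflTransGen (AdjIn G W) x z) (hz : z ≠ x) :
    ∃ y ∈ W.erase x, G.Adj x y ∧ Relation.ReflTransGen (AdjIn G (W.erase x)) y z := by
  induction h with
  | refl => exact (hz rfl).elim
  | @tail b c hb hbc ih =>
    have hc : c ∈ W.erase x := Finset.mem_erase.2 ⟨hz, hbc.2.2⟩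
    by_cases hbx : b = x
    · subst hbx
      exact ⟨c, hc, hbc.1, .refl⟩
    · obtain ⟨y, hy, hxy, hyb⟩ := ih hbx
      exact ⟨y, hy, hxy, hyb.tail ⟨hbc.1, Finset.mem_erase.2 ⟨hbx, hbc.2.1⟩, hc⟩⟩

variable (G) in
/-- There are at least `M` disjoint nonempty sets of at most `K` vertices of `W` outside of `S`,
each having all its neighbours in `W` in itself or in `S`. -/
def HasSmallPieces (W S : Finset α) (K M : ℕ) : Prop :=
  ∃ 𝒬 : Finset (Finset α), M ≤ 𝒬.card ∧ (∀ Q ∈ 𝒬, ∀ Q' ∈ 𝒬, Q ≠ Q' → Disjoint Q Q') ∧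
    ∀ Q ∈ 𝒬, Q.Nonempty ∧ Q ⊆ W ∧ Disjoint Q S ∧ Q.card ≤ K ∧
      ∀ u ∈ Q, ∀ v ∈ W, G.Adj u v → v ∈ Q ∨ v ∈ S

-- If all components have at most `K` vertices, covering `M * K` vertices takes at least `M` of
-- them, and components are closed under adjacency in `W`.
open Classical in
theorem exists_large_compIn_or_hasSmallPieces {W : Finset α} {K M : ℕ} (hK : 0 < K)
    (hW : M * K ≤ W.card) :
    (∃ y ∈ W, K < (compIn G W y).card) ∨ HasSmallPieces G W ∅ K M := by
  by_cases h : ∃ y ∈ W, K < (compIn G W y).card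
  · exact Or.inl h
  right
  push Not at h
  refine ⟨W.image (compIn G W), ?_, ?_, ?_⟩
  · have h1 : W ⊆ (W.image (compIn G W)).biUnion id := by
      intro x hx
      exact Finset.mem_biUnion.2 ⟨_, Finset.mem_image_of_mem _ hx, mem_compIn_self hx⟩
    have h2 := (Finset.card_le_card h1).trans (Finset.card_biUnion_le_card_mul _ id K (by
      intro Q hQ
      obtain ⟨y, hy, rfl⟩ := Finset.mem_image.1 hQ
      exact h y hy))
    exact Nat.le_of_mul_le_mul_right (hW.trans h2) hK
  · intro Q hQ Q' hQ' hne
    obtain ⟨y, hy, rfl⟩ := Finset.mem_image.1 hQ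
    obtain ⟨y', hy', rfl⟩ := Finset.mem_image.1 hQ'
    rw [Finset.disjoint_left]
    intro x hx hx'
    exact hne ((compIn_eq_of_mem hx).trans (compIn_eq_of_mem hx').symm)
  · intro Q hQ
    obtain ⟨y, hy, rfl⟩ := Finset.mem_image.1 hQ
    exact ⟨⟨y, mem_compIn_self hy⟩, compIn_subset _ _, Finset.disjoint_empty_right _, h y hy,
      fun u hu v hv huv => Or.inl (mem_compIn_of_adj hu hv huv)⟩

theorem HasSmallPieces.mono {W S : Finset α} {K K' M : ℕ} (h : HasSmallPieces G W S K M)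
    (hK : K ≤ K') : HasSmallPieces G W S K' M := by
  obtain ⟨𝒬, h1, h2, h3⟩ := h
  exact ⟨𝒬, h1, h2, fun Q hQ => ⟨(h3 Q hQ).1, (h3 Q hQ).2.1, (h3 Q hQ).2.2.1,
    (h3 Q hQ).2.2.2.1.trans hK, (h3 Q hQ).2.2.2.2⟩⟩

theorem HasSmallPieces.of_subset {W W' S' : Finset α} {K M : ℕ}
    (h : HasSmallPieces G W' ∅ K M) (hW : W' ⊆ W) (hS : Disjoint W' S')
    (hcl : ∀ u ∈ W', ∀ v ∈ W, G.Adj u v → v ∈ W' ∨ v ∈ S') : HasSmallPieces G W S' K M := by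
  obtain ⟨𝒬, h1, h2, h3⟩ := h
  refine ⟨𝒬, h1, h2, fun Q hQ => ?_⟩
  obtain ⟨hne, hsub, -, hcard, hadj⟩ := h3 Q hQ
  refine ⟨hne, hsub.trans hW, hS.mono_left hsub, hcard, fun u hu v hv huv => ?_⟩
  rcases hcl u (hsub hu) v hv huv with hv' | hv'
  · exact Or.inl ((hadj u hu v hv' huv).resolve_right (Finset.notMem_empty v))
  · exact Or.inr hv'

-- Depth-first descent on the bound `j` for paths starting at the root `x`. Move `x` to the
-- separator `S`. If a component of the rest has more than `M ^ j` vertices, continue in it from a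
-- neighbour of `x`; prefixing `x` shows that paths from the new root are one shorter. Otherwise the
-- at least `M * M ^ j` remaining vertices split into at least `M` components of size at most `M ^
-- j`.
open Classical in
theorem exists_hasSmallPieces_of_rooted {M : ℕ} (hM : 0 < M) {W₀ : Finset α} :
    ∀ (j : ℕ) (W S : Finset α) (x : α), W ⊆ W₀ → S ⊆ W₀ → Disjoint W S →
      (∀ u ∈ W, ∀ v ∈ W₀, G.Adj u v → v ∈ W ∨ v ∈ S) →
      x ∈ W → (∀ z ∈ W, Relation.ReflTransGen (AdjIn G W) x z) →
      (∀ l, IsPathList G l → (∀ y ∈ l, y ∈ W) → l.head? = some x → l.length ≤ j) →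
      M ^ j < W.card → ∃ S' ⊆ W₀, S'.card ≤ S.card + j ∧ HasSmallPieces G W₀ S' (M ^ j) M := by
  intro j
  induction j with
  | zero =>
    intro W S x _ _ _ _ hx _ hlen _
    have := hlen [x] (isPathList_singleton x) (by simpa using hx) rfl
    simp at this
  | succ j ih =>
    intro W S x hW hS hWS hcl hx hreach hlen hcard
    have hScard : (insert x S).card ≤ S.card + 1 := Finset.card_insert_le _ _
    have hS' : insert x S ⊆ W₀ := Finset.insert_subset (hW hx) hS
    have hW' : W.erase x ⊆ W₀ := (Finset.erase_subset _ _).trans hW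
    have hdisj : Disjoint (W.erase x) (insert x S) := by
      rw [Finset.disjoint_insert_right]
      exact ⟨Finset.notMem_erase _ _, hWS.mono_left (Finset.erase_subset _ _)⟩
    have hcl' : ∀ u ∈ W.erase x, ∀ v ∈ W₀, G.Adj u v → v ∈ W.erase x ∨ v ∈ insert x S := by
      intro u hu v hv huv
      by_cases hvx : v = x
      · exact Or.inr (by simp [hvx])
      rcases hcl u (Finset.mem_of_mem_erase hu) v hv huv with h | h
      · exact Or.inl (Finset.mem_erase.2 ⟨hvx, h⟩)
      · exact Or.inr (Finset.mem_insert_of_mem h)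
    have hmono : M ^ j ≤ M ^ (j + 1) := Nat.pow_le_pow_right hM (Nat.le_succ j)
    rcases exists_large_compIn_or_hasSmallPieces (G := G) (W := W.erase x) (M := M)
      (pow_pos hM j) (by
        rw [Finset.card_erase_of_mem hx, ← pow_succ']
        exact Nat.le_sub_one_of_lt hcard) with ⟨y, hy, hbig⟩ | hsm
    · obtain ⟨y₀, hy₀, hxy₀, hr⟩ := exists_adj_reflTransGen_erase
        (hreach y (Finset.mem_of_mem_erase hy)) (Finset.ne_of_mem_erase hy)
      rw [← compIn_eq_of_mem (mem_compIn.2 ⟨hy, hr⟩)] at hbig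
      have hsub := compIn_subset (G := G) (W.erase x) y₀
      obtain ⟨S', hS'W, hS'c, hS'p⟩ := ih (compIn G (W.erase x) y₀) (insert x S) y₀
        (hsub.trans hW') hS' (hdisj.mono_left hsub)
        (fun u hu v hv huv => (hcl' u (hsub hu) v hv huv).imp_left
          fun hv' => mem_compIn_of_adj hu hv' huv)
        (mem_compIn_self hy₀) (fun z hz => reflTransGen_adjIn_compIn hz)
        (fun l hl hlW hhead => by
          have h1 : IsPathList G (x :: l) := by
            refine (isPathList_singleton x).append hl ?_ ?_
            · intro a ha ha'
              rw [List.mem_singleton] at ha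
              subst ha
              exact Finset.notMem_erase _ _ (hsub (hlW _ ha'))
            · intro a ha b hb
              rw [hhead] at hb
              have e1 : x = a := by simpa using ha
              have e2 : y₀ = b := by simpa using hb
              rw [← e1, ← e2]
              exact hxy₀
          have h2 := hlen (x :: l) h1 (by
            intro a ha
            rcases List.mem_cons.1 ha with rfl | ha
            · exact hx
            · exact Finset.mem_of_mem_erase (hsub (hlW _ ha))) rfl
          simpa using h2)
        hbig
      exact ⟨S', hS'W, by omega, hS'p.mono hmono⟩
    · exact ⟨insert x S, hS', by omega, (hsm.of_subset hW' hdisj hcl').mono hmono⟩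

/-- A large set of vertices without long paths splits, after the deletion of few vertices, into
many pieces of bounded size (and possibly a rest). -/
theorem exists_hasSmallPieces {M m : ℕ} (hM : 0 < M) {W : Finset α}
    (hlen : ∀ l, IsPathList G l → (∀ y ∈ l, y ∈ W) → l.length ≤ m) (hW : M * M ^ m ≤ W.card) :
    ∃ S ⊆ W, S.card ≤ m ∧ HasSmallPieces G W S (M ^ m) M := by
  rcases exists_large_compIn_or_hasSmallPieces (G := G) (pow_pos hM m) hW with ⟨y, hy, hbig⟩ | h
  · have hsub := compIn_subset (G := G) W y
    obtain ⟨S, hS, hSc, hSp⟩ := exists_hasSmallPieces_of_rooted hM m (compIn G W y) ∅ y hsub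
      (Finset.empty_subset _) (Finset.disjoint_empty_right _)
      (fun u hu v hv huv => Or.inl (mem_compIn_of_adj hu hv huv)) (mem_compIn_self hy)
      (fun z hz => reflTransGen_adjIn_compIn hz)
      (fun l hl hlW _ => hlen l hl fun y hy => hsub (hlW y hy)) hbig
    exact ⟨S, hS, by simpa using hSc, hSp⟩
  · exact ⟨∅, Finset.empty_subset _, by simp, h⟩

end Components

/-! ### Finding `ℓ - 1` vertices with many common neighbours -/

section CommonNeighbours

variable {α : Type*} {G : SimpleGraph α}

open Classical in
/-- In a set `Q` that meets many edges of `Q ∪ S`, a vertex with many neighbours in `S` can be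
found, or one that starts a long path in `Q`, while `Q` contains an even longer path. -/
theorem exists_vertex_of_adjCount (ℓ : ℕ) (hℓ : 1 ≤ ℓ) (S Q : Finset α) (hQ : Q.Nonempty)
    (h : 2 * ((ℓ : ℤ) - 1) * Q.card ≤ adjCount G Q Q + 2 * adjCount G Q S) :
    ∃ v ∈ Q, ℓ - 1 ≤ (S.filter (G.Adj v)).card ∨ ∃ r, 1 ≤ r ∧
      r + (S.filter (G.Adj v)).card + 1 = ℓ ∧
      (∃ P, IsPathList G P ∧ (∀ x ∈ P, x ∈ Q) ∧ 2 * r + 1 ≤ P.length) ∧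
      ∃ T, IsPathList G T ∧ (∀ x ∈ T, x ∈ Q) ∧ T.head? = some v ∧ r + 1 ≤ T.length := by
  induction Q using Finset.strongInduction with
  | H Q ih =>
  by_cases hmin : ∃ u ∈ Q, (Q.erase u).Nonempty ∧ 2 * ((ℓ : ℤ) - 1) * (Q.erase u).card ≤
      adjCount G (Q.erase u) (Q.erase u) + 2 * adjCount G (Q.erase u) S
  · obtain ⟨u, hu, hne, hle⟩ := hmin
    have hsub := Finset.erase_subset u Q
    obtain ⟨v, hv, hcase⟩ := ih _ (Finset.erase_ssubset hu) hne hle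
    refine ⟨v, hsub hv, hcase.imp_right ?_⟩
    rintro ⟨r, h1, h2, ⟨P, hP, hPQ, hPl⟩, T, hT, hTQ, hTh, hTl⟩
    exact ⟨r, h1, h2, ⟨P, hP, fun x hx => hsub (hPQ x hx), hPl⟩, T, hT,
      fun x hx => hsub (hTQ x hx), hTh, hTl⟩
  push Not at hmin
  -- From here no vertex of `Q` can be deleted without losing the inequality, except when `Q` is a
  -- single vertex. The maximal degree `d` into `S` bounds what every vertex of `Q` sends to `S`.
  obtain ⟨v, hv, hmax⟩ := Finset.exists_max_image Q (fun v => (S.filter (G.Adj v)).card) hQ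
  refine ⟨v, hv, ?_⟩
  by_cases hd : ℓ - 1 ≤ (S.filter (G.Adj v)).card
  · exact Or.inl hd
  right
  have hQS : adjCount G Q S ≤ Q.card * (S.filter (G.Adj v)).card := by
    rw [adjCount_eq_sum]
    calc _ ≤ ∑ u ∈ Q, ((S.filter (G.Adj v)).card : ℤ) := by
          refine Finset.sum_le_sum fun u hu => ?_
          rw [adjCount_singleton_left]
          exact_mod_cast hmax u hu
      _ = _ := by simp
  set d := (S.filter (G.Adj v)).card with hd_def
  obtain ⟨r, hr⟩ : ∃ r, r + d + 1 = ℓ := ⟨ℓ - 1 - d, by omega⟩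
  have hr1 : 1 ≤ r := by omega
  have hrℓ : (ℓ : ℤ) - 1 = r + d := by omega
  rw [hrℓ] at h
  refine ⟨r, hr1, hr, ?_, ?_⟩
  -- At most `d` edges per vertex go to `S`, so the average degree inside `Q` is at least `2 * r`.
  · refine exists_pathList_of_adjCount r Q hQ ?_
    nlinarith
  -- As deleting `u` destroys the inequality, `u` has more than `r + d` neighbours in `Q` and `S`
  -- together, hence at least `r` in `Q`.
  · obtain ⟨T, hT, hTQ, hTh, hTl⟩ := exists_pathList_from (G := G) (r := r) hv (by
      intro u hu
      by_cases hne : (Q.erase u).Nonempty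
      · have h1 := hmin u hu hne
        rw [hrℓ] at h1
        have h2 := adjCount_erase_self G hu
        have h3 : adjCount G Q S = adjCount G {u} S + adjCount G (Q.erase u) S := by
          rw [← adjCount_union_left G (by simp), ← Finset.insert_eq, Finset.insert_erase hu]
        have h4 : (Q.card : ℤ) = (Q.erase u).card + 1 := by
          exact_mod_cast (Finset.card_erase_add_one hu).symm
        have h5 : adjCount G {u} S ≤ d := by
          rw [adjCount_singleton_left]
          exact_mod_cast hmax u hu
        rw [h4] at h
        have h6 : (r : ℤ) ≤ adjCount G {u} Q := by nlinarith
        rw [adjCount_singleton_left] at h6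
        exact_mod_cast h6
      · rw [Finset.not_nonempty_iff_eq_empty] at hne
        have hQu : Q = {u} := by
          rw [← Finset.insert_erase hu, hne]
          simp
        rw [hQu, adjCount_singleton_self] at h
        rw [hQu] at hQS
        simp at h hQS
        omega)
    exact ⟨T, hT, hTQ, hTh, hTl.ge⟩

/-- Paths that are covered by pieces of depth `r` need few connecting vertices. -/
theorem sum_sub_le {k : ℕ} (hk : 2 ≤ k) {a : Fin k → ℕ} (ha : ∀ i, 1 ≤ a i) {r d : ℕ} (hr : 1 ≤ r)
    (hd : r + d + 1 = ∑ i, a i) : ∑ i, (a i - r) ≤ d := by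
  by_cases h : ∃ i, r < a i
  · obtain ⟨i, hi⟩ := h
    obtain ⟨j, hj⟩ : ∃ j : Fin k, j ≠ i := by
      have : Nontrivial (Fin k) := Fin.nontrivial_iff_two_le.2 hk
      exact exists_ne i
    -- The term `i` saves exactly `r` and the other term `j` saves at least one; this is where `k ≥
    -- 2` enters.
    have h1 : ∑ t, ((a t - r) + (if t = i then r else 0) + if t = j then 1 else 0) ≤ ∑ t, a t := by
      refine Finset.sum_le_sum fun t _ => ?_
      have := ha t
      by_cases hti : t = i
      · subst hti
        rw [if_pos rfl, if_neg hj.symm]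
        omega
      · rw [if_neg hti]
        split_ifs <;> omega
    simp [Finset.sum_add_distrib] at h1
    omega
  · push Not at h
    have : ∑ i, (a i - r) = 0 := Finset.sum_eq_zero fun i _ => Nat.sub_eq_zero_of_le (h i)
    omega

open Classical in
/-- Many disjoint pieces with the same set `D` of neighbours of their roots yield the linear
forest. -/
theorem linearForest_isContained_of_rooted_pieces {k : ℕ} (hk : 2 ≤ k) {p : Fin k → ℕ}
    (hp : ∀ i, 3 ≤ p i) {r : ℕ} (hr : 1 ≤ r) (D : Finset α)
    (hrD : r + D.card + 1 = ∑ i, p i / 2) (ℱ : Finset (Finset α))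
    (hcard : k + ∑ i, p i / 2 ≤ ℱ.card)
    (hdisj : ∀ Q ∈ ℱ, ∀ Q' ∈ ℱ, Q ≠ Q' → Disjoint Q Q')
    (hDQ : ∀ Q ∈ ℱ, Disjoint Q D)
    (hpieces : ∀ Q ∈ ℱ, ∃ v, (∀ d ∈ D, G.Adj v d) ∧
      (∃ P, IsPathList G P ∧ (∀ x ∈ P, x ∈ Q) ∧ 2 * r + 1 ≤ P.length) ∧
      ∃ T, IsPathList G T ∧ (∀ x ∈ T, x ∈ Q) ∧ T.head? = some v ∧ r + 1 ≤ T.length) :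
    linearForest p ⊑ G := by
  have hpieces' : ∀ Q : ℱ, ∃ v, (∀ d ∈ D, G.Adj v d) ∧
      (∃ P, IsPathList G P ∧ (∀ x ∈ P, x ∈ Q.1) ∧ 2 * r + 1 ≤ P.length) ∧
      ∃ T, IsPathList G T ∧ (∀ x ∈ T, x ∈ Q.1) ∧ T.head? = some v ∧ r + 1 ≤ T.length :=
    fun Q => hpieces Q.1 Q.2
  choose v hv hP hT using hpieces'
  choose P hP using hP
  choose T hT using hT
  -- If `c i = 0`, then `p i ≤ 2 * r + 1` and the path `P` of one piece suffices. Otherwise a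
  -- reversed `T`, continued through `c i` connectors, reaches `(r + 1) + 2 * c i + r = 2 * (p i /
  -- 2) + 1` vertices.
  let c : Fin k → ℕ := fun i => p i / 2 - r
  have hc : ∑ i, c i ≤ D.card :=
    sum_sub_le hk (fun i => by have := hp i; omega) hr hrD
  obtain ⟨e⟩ : Nonempty (Fin k ⊕ Fin (∑ i, c i) ↪ ℱ) :=
    Function.Embedding.nonempty_of_card_le (by simp; omega)
  have hsep : ∀ a b, a ≠ b → ∀ x, x ∈ (e a).1 → x ∉ (e b).1 := by
    intro a b hab x hx hx'
    refine Finset.disjoint_left.1 (hdisj _ (e a).2 _ (e b).2 fun h => hab ?_) hx hx'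
    exact e.injective (Subtype.ext h)
  let h : Fin k → List α := fun i =>
    if c i = 0 then P (e (Sum.inl i)) else (T (e (Sum.inl i))).reverse
  have hmem : ∀ i, ∀ x ∈ h i, x ∈ (e (Sum.inl i)).1 := by
    intro i x hx
    by_cases hci : c i = 0
    · simp only [h, if_pos hci] at hx
      exact (hP _).2.1 x hx
    · simp only [h, if_neg hci, List.mem_reverse] at hx
      exact (hT _).2.1 x hx
  refine linearForest_isContained_of_pieces r c D h (fun j => T (e (Sum.inr j))) hc (by simp)
    ?_ (fun j => (hT _).1) ?_ ?_ ?_ ?_ ?_ (fun j => (hT _).2.2.2) ?_ ?_ ?_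
  · intro i
    by_cases hci : c i = 0
    · simp only [h, if_pos hci]
      exact (hP _).1
    · simp only [h, if_neg hci]
      exact (hT _).1.reverse
  · intro i i' hii' x hx hx'
    exact hsep _ _ (fun h => hii' (Sum.inl_injective h)) x (hmem i x hx) (hmem i' x hx')
  · intro j j' hjj' x hx hx'
    exact hsep _ _ (fun h => hjj' (Sum.inr_injective h)) x ((hT _).2.1 x hx) ((hT _).2.1 x hx')
  · intro i j x hx hx'
    exact hsep _ _ Sum.inl_ne_inr x (hmem i x hx) ((hT _).2.1 x hx')
  · intro d hd i hx
    exact Finset.disjoint_left.1 (hDQ _ (e (Sum.inl i)).2) (hmem i d hx) hd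
  · intro d hd j hx
    exact Finset.disjoint_left.1 (hDQ _ (e (Sum.inr j)).2) ((hT _).2.1 d hx) hd
  · intro i hci d hd z hz
    simp only [h, if_neg hci.ne', List.getLast?_reverse, (hT _).2.2.1, Option.mem_def,
      Option.some.injEq] at hz
    subst hz
    exact hv _ d hd
  · intro j d hd z hz
    simp only [(hT _).2.2.1, Option.mem_def, Option.some.injEq] at hz
    subst hz
    exact (hv _ d hd).symm
  · intro i
    by_cases hci : c i = 0
    · have := (hP (e (Sum.inl i))).2.2
      simp only [h, if_pos hci]
      simp only [c] at hci
      omega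
    · have := (hT (e (Sum.inl i))).2.2.2
      simp only [h, if_neg hci, List.length_reverse]
      simp only [c] at hci ⊢
      omega

open Classical in
/-- A dense subset of vertices in which every small set meets many edges. -/
theorem exists_robust_subset [Fintype α] (a K N C : ℕ)
    (hn : (K + 1) * N ^ 2 + (K + 1) * C < Fintype.card α)
    (hG : 2 * (a : ℤ) * Fintype.card α - C ≤ adjCount G Finset.univ Finset.univ) :
    ∃ W : Finset α, N ≤ W.card ∧ ∀ U ⊆ W, U.card ≤ K →
      2 * (a : ℤ) * U.card ≤ adjCount G U U + 2 * adjCount G U (W \ U) := by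
  -- The price per vertex is slightly below `2 * a` times `K + 1`. The whole vertex set then has
  -- weight at least `n - (K + 1) * C`, too much for a small `W`. Deleting a set of at most `K`
  -- vertices that falls short of the claimed inequality by at least one would increase the weight.
  obtain ⟨W, -, hW⟩ := Finset.exists_max_image (Finset.univ : Finset (Finset α))
    (fun W => ((K : ℤ) + 1) * adjCount G W W - (2 * (K + 1) * a - 1) * W.card)
    Finset.univ_nonempty
  refine ⟨W, ?_, ?_⟩
  · by_contra! hlt
    have h1 := hW Finset.univ (Finset.mem_univ _)
    simp only [Finset.card_univ] at h1
    have h2 := adjCount_le_card_mul_card G W W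
    have h3 : (W.card : ℤ) < N := by exact_mod_cast hlt
    have hn' : ((K : ℤ) + 1) * N ^ 2 + (K + 1) * C < Fintype.card α := by exact_mod_cast hn
    have h4 : (0 : ℤ) ≤ W.card := by positivity
    have h5 : (0 : ℤ) ≤ a := by positivity
    have h6 : (0 : ℤ) ≤ K := by positivity
    have h7 : ((K : ℤ) + 1) * adjCount G W W - (2 * (K + 1) * a - 1) * W.card
        ≤ (K + 1) * N ^ 2 := by
      rcases Nat.eq_zero_or_pos a with ha | ha
      · have e1 : adjCount G W W ≤ W.card * (W.card - 1) := adjCount_self_le G W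
        rw [ha]
        have : ((K : ℤ) + 1) * adjCount G W W ≤ (K + 1) * (W.card * (W.card - 1)) := by gcongr
        have : (W.card : ℤ) * (W.card - 1) + W.card ≤ N ^ 2 := by nlinarith
        have : ((K : ℤ) + 1) * (W.card * (W.card - 1) + W.card) ≤ (K + 1) * N ^ 2 := by gcongr
        simp
        nlinarith
      · have ha' : (1 : ℤ) ≤ a := by exact_mod_cast ha
        have e1 : adjCount G W W ≤ N ^ 2 := by nlinarith
        have e2 : ((K : ℤ) + 1) * adjCount G W W ≤ (K + 1) * N ^ 2 := by gcongr
        have e3 : 0 ≤ (2 * ((K : ℤ) + 1) * a - 1) * W.card := by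
          apply mul_nonneg _ h4
          nlinarith
        linarith
    have h8 : ((K : ℤ) + 1) * (2 * a * Fintype.card α - C)
        ≤ (K + 1) * adjCount G Finset.univ Finset.univ := by gcongr
    nlinarith
  · intro U hU hUK
    have h1 := hW (W \ U) (Finset.mem_univ _)
    have h2 := adjCount_sdiff_self G hU
    have h3 : (W.card : ℤ) = (W \ U).card + U.card := by
      exact_mod_cast (Finset.card_sdiff_add_card_eq_card hU).symm
    rw [h2, h3] at h1
    by_contra! hlt
    have h4 : adjCount G U U + 2 * adjCount G U (W \ U) ≤ 2 * (a : ℤ) * U.card - 1 := by omega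
    have h5 : ((K : ℤ) + 1) * (adjCount G U U + 2 * adjCount G U (W \ U))
        ≤ (K + 1) * (2 * (a : ℤ) * U.card - 1) := by gcongr
    have h6 : (U.card : ℤ) ≤ K := by exact_mod_cast hUK
    nlinarith

open Classical in
/-- A large graph without the linear forest `P_{p 0} ∪ … ∪ P_{p (k-1)}` that has nearly `(ℓ-1) n`
edges contains `ℓ-1` vertices with many common neighbours. -/
theorem exists_common_neighbours {k : ℕ} (hk : 2 ≤ k) {p : Fin k → ℕ} (hp : ∀ i, 3 ≤ p i)
    (M C : ℕ) : ∃ N : ℕ, ∀ (α : Type) [Fintype α] (G : SimpleGraph α), N ≤ Fintype.card α →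
      (linearForest p).Free G →
      2 * ((∑ i, p i / 2 : ℕ) - 1 : ℤ) * Fintype.card α - C ≤ adjCount G Finset.univ Finset.univ →
      ∃ A X : Finset α, A.card = (∑ i, p i / 2) - 1 ∧ M ≤ X.card ∧
        ∀ a ∈ A, ∀ x ∈ X, G.Adj a x := by
  set ℓ := ∑ i, p i / 2 with hℓ_def
  set m := ∑ i, p i with hm_def
  have hℓ : 1 ≤ ℓ := by
    have h0 := Finset.single_le_sum (f := fun i => p i / 2) (fun _ _ => Nat.zero_le _)
      (Finset.mem_univ (⟨0, by omega⟩ : Fin k))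
    have := hp ⟨0, by omega⟩
    omega
  -- There are at most `2 ^ m` subsets of `S`, so among `M₁` pieces more than `M + k + ℓ` roots have
  -- the same neighbourhood in `S`. Pieces will have at most `K` vertices.
  set M₁ := 2 ^ m * (M + k + ℓ) + 1 with hM₁
  set K := M₁ ^ m with hK
  set N₁ := M₁ * M₁ ^ m with hN₁
  refine ⟨(K + 1) * N₁ ^ 2 + (K + 1) * C + 1, fun α _ G hn hfree hG => ?_⟩
  have : Nonempty α := Fintype.card_pos_iff.1 (by omega)
  have hℓz : ((ℓ - 1 : ℕ) : ℤ) = (ℓ : ℤ) - 1 := by omega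
  obtain ⟨W, hWN, hW⟩ := exists_robust_subset (G := G) (ℓ - 1) K N₁ C (by omega)
    (by rw [hℓz]; exact hG)
  obtain ⟨S, hSW, hSm, 𝒬, h𝒬c, h𝒬d, h𝒬⟩ := exists_hasSmallPieces (G := G) (M := M₁) (m := m)
    (by omega) (W := W) (fun l hl _ => by
      by_contra! hlt
      exact hfree (linearForest_isContained_of_list hl hlt.le)) hWN
  have hv : ∀ Q ∈ 𝒬, ∃ v ∈ Q, ℓ - 1 ≤ (S.filter (G.Adj v)).card ∨ ∃ r, 1 ≤ r ∧
      r + (S.filter (G.Adj v)).card + 1 = ℓ ∧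
      (∃ P, IsPathList G P ∧ (∀ x ∈ P, x ∈ Q) ∧ 2 * r + 1 ≤ P.length) ∧
      ∃ T, IsPathList G T ∧ (∀ x ∈ T, x ∈ Q) ∧ T.head? = some v ∧ r + 1 ≤ T.length := by
    intro Q hQ
    obtain ⟨hne, hQW, hQS, hQK, hQadj⟩ := h𝒬 Q hQ
    refine exists_vertex_of_adjCount ℓ hℓ S Q hne ?_
    have h1 := hW Q hQW hQK
    rw [hℓz] at h1
    have h2 : S ⊆ W \ Q := fun x hx =>
      Finset.mem_sdiff.2 ⟨hSW hx, fun hxQ => Finset.disjoint_left.1 hQS hxQ hx⟩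
    have h3 : adjCount G Q (W \ Q) = adjCount G Q S := by
      rw [← Finset.union_sdiff_of_subset h2, adjCount_union_right G Q Finset.disjoint_sdiff,
        adjCount_eq_zero G (W := (W \ Q) \ S), add_zero]
      intro u hu v hv huv
      rw [Finset.mem_sdiff, Finset.mem_sdiff] at hv
      rcases hQadj u hu v hv.1.1 huv with h | h
      · exact hv.1.2 h
      · exact hv.2 h
    rwa [h3] at h1
  choose! v hvQ hvcase using hv
  obtain ⟨D, hDS, hDcard⟩ := Finset.exists_lt_card_fiber_of_mul_lt_card_of_maps_to
    (s := 𝒬) (t := S.powerset) (f := fun Q => S.filter (G.Adj (v Q))) (n := M + k + ℓ)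
    (fun Q _ => Finset.mem_powerset.2 (Finset.filter_subset _ _))
    (by
      rw [Finset.card_powerset]
      have : 2 ^ S.card ≤ 2 ^ m := Nat.pow_le_pow_right (by omega) hSm
      have := Nat.mul_le_mul_right (M + k + ℓ) this
      omega)
  rw [Finset.mem_powerset] at hDS
  set ℱ := 𝒬.filter fun Q => S.filter (G.Adj (v Q)) = D with hℱ
  have hℱ𝒬 : ∀ Q ∈ ℱ, Q ∈ 𝒬 := fun Q hQ => (Finset.mem_filter.1 hQ).1
  have hvD : ∀ Q ∈ ℱ, ∀ d ∈ D, G.Adj (v Q) d := by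
    intro Q hQ d hd
    rw [← (Finset.mem_filter.1 hQ).2] at hd
    exact (Finset.mem_filter.1 hd).2
  by_cases hDℓ : ℓ - 1 ≤ D.card
  · obtain ⟨A, hAD, hA⟩ := Finset.exists_subset_card_eq hDℓ
    refine ⟨A, ℱ.image v, hA, ?_, ?_⟩
    · rw [Finset.card_image_of_injOn]
      · omega
      · intro Q hQ Q' hQ' hQQ'
        by_contra hne
        refine Finset.disjoint_left.1 (h𝒬d Q (hℱ𝒬 Q hQ) Q' (hℱ𝒬 Q' hQ') hne)
          (hvQ Q (hℱ𝒬 Q hQ)) ?_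
        rw [hQQ']
        exact hvQ Q' (hℱ𝒬 Q' hQ')
    · intro a ha x hx
      obtain ⟨Q, hQ, rfl⟩ := Finset.mem_image.1 hx
      exact (hvD Q hQ a (hAD ha)).symm
  · exfalso
    refine hfree (linearForest_isContained_of_rooted_pieces hk hp (r := ℓ - 1 - D.card)
      (by omega) D (by omega) ℱ (by omega)
      (fun Q hQ Q' hQ' => h𝒬d Q (hℱ𝒬 Q hQ) Q' (hℱ𝒬 Q' hQ'))
      (fun Q hQ => (h𝒬 Q (hℱ𝒬 Q hQ)).2.2.1.mono_right hDS) ?_)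
    intro Q hQ
    refine ⟨v Q, hvD Q hQ, ?_⟩
    rcases hvcase Q (hℱ𝒬 Q hQ) with h | ⟨r, -, hr, hPT⟩
    · rw [(Finset.mem_filter.1 hQ).2] at h
      exact (hDℓ h).elim
    · rw [(Finset.mem_filter.1 hQ).2] at hr
      obtain rfl : r = ℓ - 1 - D.card := by omega
      exact hPT

end CommonNeighbours

/-! ### Edges outside `A`: surplus at most one -/

section UpperBound

variable {α : Type*} {G : SimpleGraph α}

open Classical in
/-- If `D` is completely joined to a large set `X`, then a path `h` whose last vertex is joined to
`D` extends to a copy of the linear forest, provided that `D` is large enough. -/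
theorem linearForest_isContained_of_start {k : ℕ} {p : Fin k → ℕ} (i₀ : Fin k) (c₀ : ℕ)
    {h : List α} (hh : IsPathList G h) {D X : Finset α} (hDX : ∀ d ∈ D, ∀ x ∈ X, G.Adj d x)
    (hDh : ∀ d ∈ D, d ∉ h) (hlast : 0 < c₀ → ∀ d ∈ D, ∀ z ∈ h.getLast?, G.Adj z d)
    (hD : ∑ i, p i / 2 + c₀ ≤ D.card + p i₀ / 2)
    (hX : h.length + k + D.card ≤ X.card) (hp₀ : p i₀ ≤ h.length + 2 * c₀) :
    linearForest p ⊑ G := by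
  -- Every other component starts at a single vertex of `X` and alternates with `p i / 2` vertices
  -- of `D`, reaching `1 + 2 * (p i / 2) ≥ p i` vertices.
  let c : Fin k → ℕ := Function.update (fun i => p i / 2) i₀ c₀
  have hc : ∑ i, c i + p i₀ / 2 = ∑ i, p i / 2 + c₀ := by
    have h1 := Finset.sum_update_of_mem (Finset.mem_univ i₀) (fun i => p i / 2) c₀
    have h2 := Finset.sum_sdiff (f := fun i => p i / 2) (Finset.subset_univ {i₀})
    rw [Finset.sum_singleton] at h2
    simp only [c]
    omega
  have hX' : k + ∑ i, c i ≤ (X \ h.toFinset).card := by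
    have h1 := Finset.le_card_sdiff h.toFinset X
    have h2 := List.toFinset_card_le h
    omega
  obtain ⟨e⟩ : Nonempty (Fin k ⊕ Fin (∑ i, c i) ↪ (X \ h.toFinset : Finset α)) :=
    Function.Embedding.nonempty_of_card_le (by simpa using hX')
  have heX : ∀ j, (e j : α) ∈ X := fun j => (Finset.mem_sdiff.1 (e j).2).1
  have heh : ∀ j, (e j : α) ∉ h := fun j hj =>
    (Finset.mem_sdiff.1 (e j).2).2 (List.mem_toFinset.2 hj)
  have heD : ∀ d ∈ D, ∀ j, d ≠ e j := by
    intro d hd j hdj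
    exact (hDX d hd _ (heX j)).ne hdj
  have heinj : ∀ j j', (e j : α) = e j' → j = j' := fun j j' h => e.injective (Subtype.ext h)
  let L : Fin k → List α := fun i => if i = i₀ then h else [(e (Sum.inl i) : α)]
  have hL₀ : L i₀ = h := if_pos rfl
  have hL : ∀ i, i ≠ i₀ → L i = [(e (Sum.inl i) : α)] := fun i hi => if_neg hi
  refine linearForest_isContained_of_pieces 0 c D L (fun j => [(e (Sum.inr j) : α)])
    (by omega) (by simp) ?_ (fun j => isPathList_singleton _) ?_ ?_ ?_ ?_ ?_ (by simp) ?_ ?_ ?_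
  · intro i
    by_cases hi : i = i₀
    · rw [hi, hL₀]
      exact hh
    · rw [hL i hi]
      exact isPathList_singleton _
  · intro i i' hii' x hx hx'
    by_cases hi : i = i₀
    · subst hi
      rw [hL₀] at hx
      rw [hL i' hii'.symm, List.mem_singleton] at hx'
      exact heh _ (hx' ▸ hx)
    · rw [hL i hi, List.mem_singleton] at hx
      by_cases hi' : i' = i₀
      · rw [hi', hL₀] at hx'
        exact heh _ (hx ▸ hx')
      · rw [hL i' hi', List.mem_singleton] at hx'
        exact hii' (Sum.inl_injective (heinj _ _ (hx.symm.trans hx')))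
  · intro j j' hjj' x hx hx'
    rw [List.mem_singleton] at hx hx'
    exact hjj' (Sum.inr_injective (heinj _ _ (hx.symm.trans hx')))
  · intro i j x hx hx'
    rw [List.mem_singleton] at hx'
    by_cases hi : i = i₀
    · rw [hi, hL₀] at hx
      exact heh _ (hx' ▸ hx)
    · rw [hL i hi, List.mem_singleton] at hx
      exact Sum.inl_ne_inr (heinj _ _ (hx.symm.trans hx'))
  · intro d hd i hdi
    by_cases hi : i = i₀
    · rw [hi, hL₀] at hdi
      exact hDh d hd hdi
    · rw [hL i hi, List.mem_singleton] at hdi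
      exact heD d hd _ hdi
  · intro d hd j hdj
    rw [List.mem_singleton] at hdj
    exact heD d hd _ hdj
  · intro i hi d hd z hz
    by_cases hii : i = i₀
    · subst hii
      rw [hL₀] at hz
      refine hlast ?_ d hd z hz
      simpa [c] using hi
    · rw [hL i hii] at hz
      have : (e (Sum.inl i) : α) = z := by simpa using hz
      rw [← this]
      exact (hDX d hd _ (heX _)).symm
  · intro j d hd z hz
    have : (e (Sum.inr j) : α) = z := by simpa using hz
    rw [← this]
    exact hDX d hd _ (heX _)
  · intro i
    by_cases hi : i = i₀
    · subst hi
      have : c i = c₀ := by simp [c]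
      rw [hL₀, this]
      split_ifs <;> omega
    · have : c i = p i / 2 := by simp [c, hi]
      rw [hL i hi, this, List.length_singleton]
      split_ifs <;> omega

open Classical in
/-- A path `h` that uses one vertex `a` of `A` and ends in a vertex joined to `A`. -/
theorem linearForest_isContained_of_start_through {k : ℕ} {p : Fin k → ℕ} (i₀ : Fin k)
    (hi₀ : 4 ≤ p i₀) {h : List α} (hh : IsPathList G h) {A X : Finset α}
    (hA : A.card + 1 = ∑ i, p i / 2) (hAX : ∀ a ∈ A, ∀ x ∈ X, G.Adj a x)
    (hX : h.length + k + A.card ≤ X.card) {a : α} (ha : a ∈ A) (hAh : ∀ d ∈ A, d ≠ a → d ∉ h)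
    (hlast : ∀ d ∈ A, ∀ z ∈ h.getLast?, G.Adj z d)
    (hp₀ : p i₀ + 4 ≤ h.length + 2 * (p i₀ / 2)) : linearForest p ⊑ G := by
  have hc := Finset.card_erase_add_one ha
  -- `A` is one vertex short of `∑ i, p i / 2` and `h` spends `a`, so component `i₀` must manage
  -- with two connectors fewer.
  refine linearForest_isContained_of_start i₀ (p i₀ / 2 - 2) hh (D := A.erase a) (X := X)
    (fun d hd => hAX d (Finset.mem_of_mem_erase hd))
    (fun d hd => hAh d (Finset.mem_of_mem_erase hd) (Finset.ne_of_mem_erase hd))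
    (fun _ d hd => hlast d (Finset.mem_of_mem_erase hd)) ?_ ?_ ?_
  · omega
  · omega
  · omega

open Classical in
/-- A short path outside of `A` whose last vertex has a neighbour in `A`. -/
theorem linearForest_isContained_of_attached {k : ℕ} {p : Fin k → ℕ} (i₀ : Fin k)
    (hi₀ : 4 ≤ p i₀) {g : List α} (hg : IsPathList G g) {A X : Finset α}
    (hA : A.card + 1 = ∑ i, p i / 2) (hAX : ∀ a ∈ A, ∀ x ∈ X, G.Adj a x)
    (hX : g.length + 2 + k + A.card ≤ X.card) (hgA : ∀ d ∈ A, d ∉ g) {a : α} (ha : a ∈ A)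
    (hlast : ∀ z ∈ g.getLast?, G.Adj z a)
    (hp₀ : p i₀ + 2 ≤ g.length + 2 * (p i₀ / 2)) : linearForest p ⊑ G := by
  obtain ⟨x, hx, hxg⟩ : ∃ x ∈ X, x ∉ g.toFinset := by
    by_contra! hc
    have h1 := Finset.card_le_card (fun z hz => hc z hz : X ⊆ g.toFinset)
    have h2 := List.toFinset_card_le g
    omega
  rw [List.mem_toFinset] at hxg
  have hax := hAX a ha x hx
  have hax' : IsPathList G [a, x] := by
    refine ⟨by simpa using hax, by simpa using hax.ne⟩
  -- Ending in `x ∈ X` makes the last vertex adjacent to all of `A`. The length condition asks for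
  -- two vertices in `g` if `p i₀` is even and three if it is odd.
  refine linearForest_isContained_of_start_through i₀ hi₀ (h := g ++ [a, x])
    (hg.append hax' ?_ ?_) hA hAX (by simpa using hX) ha ?_ ?_ ?_
  · intro z hz hz'
    simp only [List.mem_cons, List.not_mem_nil, or_false] at hz'
    rcases hz' with rfl | rfl
    · exact hgA _ ha hz
    · exact hxg hz
  · intro z hz y hy
    have : a = y := by simpa using hy
    rw [← this]
    exact hlast z hz
  · intro d hd hda hdh
    rcases List.mem_append.1 hdh with hdh | hdh
    · exact hgA d hd hdh
    · simp only [List.mem_cons, List.not_mem_nil, or_false] at hdh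
      rcases hdh with rfl | rfl
      · exact hda rfl
      · exact (hAX _ hd _ hx).ne rfl
  · intro d hd z hz
    have : x = z := by simpa using hz
    rw [← this]
    exact (hAX d hd x hx).symm
  · simp
    omega

/-- Half of one entry of `p` is less than the sum of all halves. -/
theorem half_lt_sum {k : ℕ} (hk : 2 ≤ k) {p : Fin k → ℕ} (hp : ∀ i, 3 ≤ p i) (i₀ : Fin k) :
    p i₀ / 2 < ∑ i, p i / 2 := by
  have : Nontrivial (Fin k) := Fin.nontrivial_iff_two_le.2 hk
  obtain ⟨j, hj⟩ := exists_ne i₀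
  exact Finset.single_lt_sum (f := fun i => p i / 2) hj (Finset.mem_univ _) (Finset.mem_univ _)
    (Nat.div_pos (by have := hp j; omega) two_pos) (fun _ _ _ => Nat.zero_le _)

open Classical in
/-- A set outside of `A` that meets more edges than expected contains an edge completely joined
to `A`, and then all paths of the forest have odd order. -/
theorem exists_edge_of_adjCount {k : ℕ} (hk : 2 ≤ k) {p : Fin k → ℕ} (hp : ∀ i, 3 ≤ p i)
    (hp' : ∃ i, p i ≠ 3) (hfree : (linearForest p).Free G) {A X : Finset α}
    (hA : A.card + 1 = ∑ i, p i / 2) (hAX : ∀ a ∈ A, ∀ x ∈ X, G.Adj a x)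
    (hX : k + 3 * A.card + 5 ≤ X.card) (U : Finset α) (hUA : Disjoint U A)
    (hU : 2 * (A.card : ℤ) * U.card < adjCount G U U + 2 * adjCount G U A) :
    (∀ i, ¬ Even (p i)) ∧ ∃ x ∈ U, ∃ y ∈ U, G.Adj x y ∧ (∀ a ∈ A, G.Adj x a) ∧
      ∀ a ∈ A, G.Adj y a := by
  induction U using Finset.strongInduction with
  | H U ih =>
  by_cases hmin : ∃ u ∈ U, 2 * (A.card : ℤ) * (U.erase u).card <
      adjCount G (U.erase u) (U.erase u) + 2 * adjCount G (U.erase u) A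
  · obtain ⟨u, hu, hlt⟩ := hmin
    have hsub := Finset.erase_subset u U
    obtain ⟨hodd, x, hx, y, hy, h⟩ := ih _ (Finset.erase_ssubset hu) (hUA.mono_left hsub) hlt
    exact ⟨hodd, x, hsub hx, y, hsub hy, h⟩
  push Not at hmin
  -- In a minimal `U`, every vertex accounts for more than `A.card` edges.
  have hdeg : ∀ u ∈ U, A.card + 1 ≤ (U.filter (G.Adj u)).card + (A.filter (G.Adj u)).card := by
    intro u hu
    have h1 := hmin u hu
    have h2 := adjCount_erase_self G hu
    have h3 : adjCount G U A = adjCount G {u} A + adjCount G (U.erase u) A := by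
      rw [← adjCount_union_left G (by simp), ← Finset.insert_eq, Finset.insert_erase hu]
    have h4 : (U.card : ℤ) = (U.erase u).card + 1 := by
      exact_mod_cast (Finset.card_erase_add_one hu).symm
    rw [adjCount_singleton_left] at h2 h3
    rw [h4] at hU
    have h5 : (A.card : ℤ) < (U.filter (G.Adj u)).card + (A.filter (G.Adj u)).card := by
      nlinarith
    exact_mod_cast h5
  have hUA' : ∀ u ∈ U, u ∉ A := fun u hu => Finset.disjoint_left.1 hUA hu
  by_cases hatt : ∃ v ∈ U, ∃ a ∈ A, G.Adj v a
  · obtain ⟨v, hv, a, ha, hva⟩ := hatt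
    have hnbr : ∀ u ∈ U, ∃ z ∈ U, G.Adj u z := by
      intro u hu
      have h1 := hdeg u hu
      have h2 := Finset.card_filter_le A (G.Adj u)
      obtain ⟨z, hz⟩ := Finset.card_pos.1 (show 0 < (U.filter (G.Adj u)).card by omega)
      exact ⟨z, (Finset.mem_filter.1 hz).1, (Finset.mem_filter.1 hz).2⟩
    have hodd : ∀ i, ¬ Even (p i) := by
      rintro i ⟨q, hq⟩
      obtain ⟨u, hu, hvu⟩ := hnbr v hv
      have := hp i
      refine hfree (linearForest_isContained_of_attached i (by omega) (g := [u, v])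
        ⟨by simpa using hvu.symm, by simpa using hvu.ne'⟩ hA hAX (by simp; omega) ?_ ha ?_ ?_)
      · intro d hd hdg
        simp only [List.mem_cons, List.not_mem_nil, or_false] at hdg
        rcases hdg with rfl | rfl
        · exact hUA' _ hu hd
        · exact hUA' _ hv hd
      · intro z hz
        have : v = z := by simpa using hz
        exact this ▸ hva
      · simp
        omega
    obtain ⟨i₁, hi₁⟩ := hp'
    have hi₁5 : 5 ≤ p i₁ := by
      have h1 := hp i₁
      have h2 : p i₁ ≠ 4 := fun h => hodd i₁ (h ▸ by decide)
      omega
    have hi₁odd : 2 * (p i₁ / 2) + 1 = p i₁ :=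
      Nat.two_mul_div_two_add_one_of_odd (Nat.not_even_iff_odd.1 (hodd i₁))
    -- With an odd component of order at least 5 available, a three-vertex path attached to `A`
    -- already completes the forest. So in `U` an attached edge cannot be prolonged, and the degree
    -- bound then joins both its ends to all of `A`.
    have key : ∀ w ∈ U, ∀ u ∈ U, ∀ z ∈ U, G.Adj w u → G.Adj u z → w ≠ z →
        ∀ b ∈ A, ¬ G.Adj z b := by
      intro w hw u hu z hz hwu huz hwz b hb hzb
      refine hfree (linearForest_isContained_of_attached i₁ (by omega) (g := [w, u, z])
        ⟨by simpa using ⟨hwu, huz⟩, by simpa using ⟨⟨hwu.ne, hwz⟩, huz.ne⟩⟩ hA hAX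
        (by simp; omega) ?_ hb ?_ ?_)
      · intro d hd hdg
        simp only [List.mem_cons, List.not_mem_nil, or_false] at hdg
        rcases hdg with rfl | rfl | rfl
        · exact hUA' _ hw hd
        · exact hUA' _ hu hd
        · exact hUA' _ hz hd
      · intro z' hz'
        have : z = z' := by simpa using hz'
        exact this ▸ hzb
      · simp
        omega
    have hcomplete : ∀ u ∈ U, ∀ z, (∀ w ∈ U, G.Adj u w → w = z) → ∀ b ∈ A, G.Adj u b := by
      intro u hu z huz b hb
      have h1 := hdeg u hu
      have h2 : U.filter (G.Adj u) ⊆ {z} := by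
        intro w hw
        rw [Finset.mem_filter] at hw
        exact Finset.mem_singleton.2 (huz w hw.1 hw.2)
      have h3 := Finset.card_le_card h2
      rw [Finset.card_singleton] at h3
      have h4 : A.filter (G.Adj u) = A :=
        Finset.eq_of_subset_of_card_le (Finset.filter_subset _ _) (by omega)
      rw [← h4] at hb
      exact (Finset.mem_filter.1 hb).2
    obtain ⟨u, hu, hvu⟩ := hnbr v hv
    have hucomp : ∀ b ∈ A, G.Adj u b := by
      refine hcomplete u hu v fun w hw huw => ?_
      by_contra hwv
      exact key w hw u hu v hv huw.symm hvu.symm hwv a ha hva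
    have hvcomp : ∀ b ∈ A, G.Adj v b := by
      refine hcomplete v hv u fun w hw hvw => ?_
      by_contra hwu
      exact key w hw v hv u hu hvw.symm hvu hwu a ha (hucomp a ha)
    exact ⟨hodd, u, hu, v, hv, hvu.symm, hucomp, hvcomp⟩
  · exfalso
    push Not at hatt
    rw [adjCount_eq_zero G hatt] at hU
    have hUne : U.Nonempty := by
      rw [Finset.nonempty_iff_ne_empty]
      rintro rfl
      simp [adjCount] at hU
    -- With no edge to `A`, all the surplus lies inside `U`. The resulting path on `2 * A.card + 1`
    -- vertices covers any one component, and `A` with `X` supplies the others.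
    obtain ⟨l, hl, hlU, hlen⟩ := exists_pathList_of_adjCount (G := G) A.card U hUne (by linarith)
    have hlen' : (l.take (2 * A.card + 1)).length = 2 * A.card + 1 := by
      rw [List.length_take]
      omega
    have i₀ : Fin k := ⟨0, by omega⟩
    have hlt := half_lt_sum hk hp i₀
    have := hp i₀
    refine hfree (linearForest_isContained_of_start i₀ 0 (hl.take (2 * A.card + 1)) hAX ?_ ?_ ?_ ?_
      ?_)
    · intro d hd hdl
      exact hUA' d (hlU d (List.mem_of_mem_take hdl)) hd
    · intro h
      omega
    · omega
    · omega
    · omega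

open Classical in
/-- The edges outside of `A` exceed the expected number by at most one: two disjoint edges joined
to `A`, or a single one with a further neighbour outside of `A`, would yield the forest. -/
theorem adjCount_compl_le {k : ℕ} (hk : 2 ≤ k) {p : Fin k → ℕ} (hp : ∀ i, 3 ≤ p i)
    (hp' : ∃ i, p i ≠ 3) (hfree : (linearForest p).Free G) {A X : Finset α}
    (hA : A.card + 1 = ∑ i, p i / 2) (hAX : ∀ a ∈ A, ∀ x ∈ X, G.Adj a x)
    (hX : k + 3 * A.card + 5 ≤ X.card) (R : Finset α) (hRA : Disjoint R A) :
    adjCount G R R + 2 * adjCount G R A ≤ 2 * (A.card : ℤ) * R.card + 2 := by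
  by_contra! hR
  obtain ⟨hodd, x, hx, y, hy, hxy, hxA, hyA⟩ := exists_edge_of_adjCount hk hp hp' hfree hA hAX hX R
    hRA (by linarith)
  have hRA' : ∀ u ∈ R, u ∉ A := fun u hu => Finset.disjoint_left.1 hRA hu
  obtain ⟨i₁, hi₁⟩ := hp'
  have hi₁5 : 5 ≤ p i₁ := by
    have h1 := hp i₁
    have h2 : p i₁ ≠ 4 := fun h => hodd i₁ (h ▸ by decide)
    omega
  have hi₁odd : 2 * (p i₁ / 2) + 1 = p i₁ :=
    Nat.two_mul_div_two_add_one_of_odd (Nat.not_even_iff_odd.1 (hodd i₁))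
  obtain ⟨a, ha⟩ : A.Nonempty := by
    rw [← Finset.card_pos]
    have := half_lt_sum hk hp i₁
    omega
  have key : ∀ w ∈ R, ∀ u ∈ R, ∀ z ∈ R, G.Adj w u → G.Adj u z → w ≠ z → ¬ G.Adj z a := by
    intro w hw u hu z hz hwu huz hwz hza
    refine hfree (linearForest_isContained_of_attached i₁ (by omega) (g := [w, u, z])
      ⟨by simpa using ⟨hwu, huz⟩, by simpa using ⟨⟨hwu.ne, hwz⟩, huz.ne⟩⟩ hA hAX
      (by simp; omega) ?_ ha ?_ ?_)
    · intro d hd hdg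
      simp only [List.mem_cons, List.not_mem_nil, or_false] at hdg
      rcases hdg with rfl | rfl | rfl
      · exact hRA' _ hw hd
      · exact hRA' _ hu hd
      · exact hRA' _ hz hd
    · intro z' hz'
      have : z = z' := by simpa using hz'
      exact this ▸ hza
    · simp
      omega
  have hsub : ({x, y} : Finset α) ⊆ R := by
    intro z hz
    rcases Finset.mem_insert.1 hz with rfl | hz
    · exact hx
    · rwa [Finset.mem_singleton.1 hz]
  have h1 := adjCount_sdiff_self G hsub
  have h2 : adjCount G {x, y} (R \ {x, y}) = 0 := by
    refine adjCount_eq_zero G fun u hu v hv huv => ?_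
    simp only [Finset.mem_sdiff, Finset.mem_insert, Finset.mem_singleton, not_or] at hu hv
    rcases hu with rfl | rfl
    · exact key v hv.1 u hx y hy huv.symm hxy hv.2.2 (hyA a ha)
    · exact key v hv.1 u hy x hx huv.symm hxy.symm hv.2.1 (hxA a ha)
  have hcard : ({x, y} : Finset α).card = 2 := Finset.card_pair hxy.ne
  have h3 : adjCount G {x, y} {x, y} ≤ 2 := by
    have := adjCount_self_le G {x, y}
    rw [hcard] at this
    simpa using this
  have h4 : adjCount G R A = adjCount G {x, y} A + adjCount G (R \ {x, y}) A := by
    rw [← adjCount_union_left G Finset.disjoint_sdiff, Finset.union_sdiff_of_subset hsub]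
  have h5 : adjCount G {x, y} A ≤ 2 * A.card := by
    have := adjCount_le_card_mul_card G {x, y} A
    rwa [hcard] at this
  have h6 : (R.card : ℤ) = (R \ {x, y}).card + 2 := by
    have := Finset.card_sdiff_add_card_eq_card hsub
    rw [hcard] at this
    exact_mod_cast this.symm
  -- The edge `xy` is isolated in `R`, so deleting its ends lowers the surplus by at most one edge.
  -- A surplus of two would leave a second such edge, and the path `x, y, a, y', x'` then gives the
  -- forest.
  obtain ⟨-, x', hx', y', hy', hxy', hxA', hyA'⟩ := exists_edge_of_adjCount hk hp ⟨i₁, hi₁⟩ hfree hA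
    hAX hX (R \ {x, y}) (hRA.mono_left Finset.sdiff_subset) (by
      rw [h6] at hR
      nlinarith)
  simp only [Finset.mem_sdiff, Finset.mem_insert, Finset.mem_singleton, not_or] at hx' hy'
  have haR : ∀ u ∈ R, u ≠ a := fun u hu hua => hRA' u hu (hua ▸ ha)
  refine hfree (linearForest_isContained_of_start_through i₁ (by omega) (h := [x, y, a, y', x'])
    ⟨by simpa using ⟨hxy, hyA a ha, (hyA' a ha).symm, hxy'.symm⟩, ?_⟩ hA hAX
    (by simp; omega) ha ?_ ?_ ?_)
  · have := haR x hx
    have := haR y hy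
    have := haR x' hx'.1
    have := haR y' hy'.1
    have := hxy.ne
    have := hxy'.ne
    grind
  · intro d hd hda hdh
    simp only [List.mem_cons, List.not_mem_nil, or_false] at hdh
    rcases hdh with rfl | rfl | rfl | rfl | rfl
    · exact hRA' _ hx hd
    · exact hRA' _ hy hd
    · exact hda rfl
    · exact hRA' _ hy'.1 hd
    · exact hRA' _ hx'.1 hd
  · intro d hd z hz
    have : x' = z := by simpa using hz
    exact this ▸ hxA' d hd
  · simp
    omega

end UpperBound

/-! ### Graphs controlled by a single edge -/

section ControlEdge

variable {V : Type*} {F : SimpleGraph V}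

theorem exists_control_edge (hβ : edgeControlNumber F = 1) :
    ∃ u₁ u₂, IsEdgeControlSet F {s(u₁, u₂)} := by
  have hne : {m : ℕ | ∃ E' : Finset (Sym2 V), IsEdgeControlSet F (E' : Set (Sym2 V)) ∧
      E'.card = m}.Nonempty := by
    by_contra h
    -- The infimum of the empty set of naturals is `0`, so the value `1` is attained.
    rw [Set.not_nonempty_iff_eq_empty] at h
    unfold edgeControlNumber at hβ
    rw [h] at hβ
    simp at hβ
  obtain ⟨E', hE', hc⟩ := Nat.sInf_mem hne
  change E'.card = edgeControlNumber F at hc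
  rw [hβ] at hc
  obtain ⟨e, rfl⟩ := Finset.card_eq_one.1 hc
  induction e with
  | _ u₁ u₂ => exact ⟨u₁, u₂, by simpa using hE'⟩

theorem IsEdgeControlSet.swap {u₁ u₂ : V} (h : IsEdgeControlSet F {s(u₁, u₂)}) :
    IsEdgeControlSet F {s(u₂, u₁)} := by
  rwa [Sym2.eq_swap]

theorem IsEdgeControlSet.adj {u₁ u₂ : V} (h : IsEdgeControlSet F {s(u₁, u₂)}) : F.Adj u₁ u₂ :=
  h.1 rfl

theorem IsEdgeControlSet.touches {u₁ u₂ : V} (h : IsEdgeControlSet F {s(u₁, u₂)}) {a b : V}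
    (hab : F.Adj a b) : a = u₁ ∨ a = u₂ ∨ b = u₁ ∨ b = u₂ := by
  by_cases he : s(a, b) = s(u₁, u₂)
  · have := Sym2.eq_iff.1 he
    tauto
  · obtain ⟨e', he', v, hv, hv'⟩ := h.2 s(a, b) ⟨hab, he⟩
    rw [Set.mem_singleton_iff] at he'
    subst he'
    rw [Sym2.mem_iff] at hv hv'
    rcases hv with rfl | rfl <;> tauto

-- Without a common neighbour, adjacency to `u₂` would be a proper 2-colouring, as every edge has an
-- end in `{u₁, u₂}`.
open Classical in
theorem IsEdgeControlSet.exists_common_neighbour {u₁ u₂ : V}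
    (h : IsEdgeControlSet F {s(u₁, u₂)}) (hχ : 3 ≤ F.chromaticNumber) :
    ∃ w, F.Adj u₁ w ∧ F.Adj u₂ w := by
  by_contra! hno
  have hcol : F.Colorable (Fintype.card Bool) := by
    refine (SimpleGraph.Coloring.mk (fun v => decide (F.Adj u₂ v)) ?_).colorable
    intro a b hab
    have h12 := h.adj
    rcases h.touches hab with rfl | rfl | rfl | rfl
    · simp [h12.symm, hno b hab]
    · simp [hab]
    · simp [h12.symm, hno a hab.symm]
    · simp [hab.symm]
  have := hχ.trans hcol.chromaticNumber_le
  rw [Fintype.card_bool] at this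
  exact absurd this (by decide)

/-- Every triangle contains the control edge. -/
theorem IsEdgeControlSet.eq_of_isNClique_three {u₁ u₂ : V} [DecidableEq V]
    (h : IsEdgeControlSet F {s(u₁, u₂)}) {s : Finset V} (hs : F.IsNClique 3 s) :
    ∃ w, F.Adj u₁ w ∧ F.Adj u₂ w ∧ s = {u₁, u₂, w} := by
  obtain ⟨a, b, c, hab, hac, hbc, rfl⟩ := is3Clique_iff.1 hs
  have h1 := h.touches hab
  have h2 := h.touches hac
  have h3 := h.touches hbc
  have n1 := hab.ne
  have n2 := hac.ne
  have n3 := hbc.ne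
  have key : (a = u₁ ∧ b = u₂) ∨ (a = u₂ ∧ b = u₁) ∨ (a = u₁ ∧ c = u₂) ∨ (a = u₂ ∧ c = u₁) ∨
      (b = u₁ ∧ c = u₂) ∨ (b = u₂ ∧ c = u₁) := by
    grind
  rcases key with ⟨rfl, rfl⟩ | ⟨rfl, rfl⟩ | ⟨rfl, rfl⟩ | ⟨rfl, rfl⟩ | ⟨rfl, rfl⟩ | ⟨rfl, rfl⟩
  · exact ⟨c, hac, hbc, rfl⟩
  · exact ⟨c, hbc, hac, by grind⟩
  · exact ⟨b, hab, hbc.symm, by grind⟩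
  · exact ⟨b, hbc.symm, hab, by grind⟩
  · exact ⟨a, hab.symm, hac.symm, by grind⟩
  · exact ⟨a, hac.symm, hab.symm, by grind⟩

open Classical in
theorem IsEdgeControlSet.unique_of_triangleCount {u₁ u₂ : V}
    (h : IsEdgeControlSet F {s(u₁, u₂)}) (ht : triangleCount F = 1) {w w' : V}
    (h₁ : F.Adj u₁ w) (h₂ : F.Adj u₂ w) (h₁' : F.Adj u₁ w') (h₂' : F.Adj u₂ w') : w' = w := by
  obtain ⟨s, hs⟩ := Set.ncard_eq_one.1 ht
  have m1 : ({u₁, u₂, w} : Finset V) ∈ F.cliqueSet 3 :=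
    is3Clique_triple_iff.2 ⟨h.adj, h₁, h₂⟩
  have m2 : ({u₁, u₂, w'} : Finset V) ∈ F.cliqueSet 3 :=
    is3Clique_triple_iff.2 ⟨h.adj, h₁', h₂'⟩
  rw [hs, Set.mem_singleton_iff] at m1 m2
  have h3 : w' ∈ ({u₁, u₂, w} : Finset V) := by
    rw [m1, ← m2]
    simp
  simp only [Finset.mem_insert, Finset.mem_singleton] at h3
  rcases h3 with rfl | rfl | h3
  · exact (h₁'.ne rfl).elim
  · exact (h₂'.ne rfl).elim
  · exact h3

theorem exists_control_edge_of_minControlDegree_le (hβ : edgeControlNumber F = 1) {ℓ : ℕ}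
    (hf : minControlDegree F ≤ ℓ) :
    ∃ u₁ u₂, IsEdgeControlSet F {s(u₁, u₂)} ∧ (F.neighborSet u₁).ncard ≤ ℓ := by
  have hne : {m : ℕ | ∃ u₁ u₂ : V, IsEdgeControlSet F {s(u₁, u₂)} ∧
      m = min (F.neighborSet u₁).ncard (F.neighborSet u₂).ncard}.Nonempty := by
    obtain ⟨u₁, u₂, h⟩ := exists_control_edge hβ
    exact ⟨_, u₁, u₂, h, rfl⟩
  obtain ⟨u₁, u₂, h, hm⟩ := Nat.sInf_mem hne
  change minControlDegree F = _ at hm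
  rw [hm, min_le_iff] at hf
  rcases hf with hf | hf
  · exact ⟨u₁, u₂, h, hf⟩
  · exact ⟨u₂, u₁, h.swap, hf⟩

theorem minControlDegree_le {u₁ u₂ : V} (h : IsEdgeControlSet F {s(u₁, u₂)}) :
    minControlDegree F ≤ (F.neighborSet u₁).ncard :=
  le_trans (Nat.sInf_le ⟨u₁, u₂, h, rfl⟩) (min_le_left _ (F.neighborSet u₂).ncard)

variable {α : Type*} {G : SimpleGraph α}

/-- Every edge meets `u₁` or `u₂`, so an injection need only respect adjacency at these two
vertices. -/
theorem IsEdgeControlSet.isContained {u₁ u₂ : V} (h : IsEdgeControlSet F {s(u₁, u₂)})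
    (f : V → α) (hf : Function.Injective f) (h₁ : ∀ v, F.Adj u₁ v → G.Adj (f u₁) (f v))
    (h₂ : ∀ v, F.Adj u₂ v → G.Adj (f u₂) (f v)) : F ⊑ G := by
  refine ⟨⟨⟨f, ?_⟩, hf⟩⟩
  intro a b hab
  rcases h.touches hab with rfl | rfl | rfl | rfl
  · exact h₁ b hab
  · exact h₂ b hab
  · exact (h₁ a hab.symm).symm
  · exact (h₂ a hab.symm).symm

open Classical in
/-- An edge with many common neighbours contains `F`. -/
theorem IsEdgeControlSet.isContained_of_book [Fintype V] {u₁ u₂ : V}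
    (h : IsEdgeControlSet F {s(u₁, u₂)}) {x y : α} (hxy : G.Adj x y) {Y : Finset α}
    (hx : ∀ z ∈ Y, G.Adj x z) (hy : ∀ z ∈ Y, G.Adj y z) (hY : Fintype.card V ≤ Y.card + 2) :
    F ⊑ G := by
  have hc : (Finset.univ \ {u₁, u₂} : Finset V).card + 2 = Fintype.card V := by
    have := Finset.card_sdiff_add_card_eq_card (Finset.subset_univ ({u₁, u₂} : Finset V))
    rwa [Finset.card_pair h.adj.ne, Finset.card_univ] at this
  obtain ⟨e⟩ : Nonempty ((Finset.univ \ {u₁, u₂} : Finset V) ↪ Y) :=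
    Function.Embedding.nonempty_of_card_le (by simp only [Fintype.card_coe]; omega)
  have hmem : ∀ v, v ≠ u₁ → v ≠ u₂ → v ∈ (Finset.univ \ {u₁, u₂} : Finset V) := by
    intro v h1 h2
    simp [h1, h2]
  let f : V → α := fun v => if h1 : v = u₁ then x else if h2 : v = u₂ then y else
    e ⟨v, hmem v h1 h2⟩
  have f1 : f u₁ = x := by simp [f]
  have f2 : f u₂ = y := by simp [f, h.adj.ne']
  have f3 : ∀ v (h1 : v ≠ u₁) (h2 : v ≠ u₂), f v = e ⟨v, hmem v h1 h2⟩ := by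
    intro v h1 h2
    simp [f, h1, h2]
  have f4 : ∀ v, v ≠ u₁ → v ≠ u₂ → f v ∈ Y := by
    intro v h1 h2
    rw [f3 v h1 h2]
    exact (e _).2
  have hcases : ∀ v, v = u₁ ∨ v = u₂ ∨ (v ≠ u₁ ∧ v ≠ u₂) := by
    intro v
    tauto
  refine h.isContained f ?_ ?_ ?_
  · intro a b hab
    rcases hcases a with rfl | rfl | ⟨ha1, ha2⟩ <;> rcases hcases b with rfl | rfl | ⟨hb1, hb2⟩
    · rfl
    · rw [f1, f2] at hab
      exact (hxy.ne hab).elim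
    · rw [f1] at hab
      exact ((hx _ (hab ▸ f4 b hb1 hb2)).ne rfl).elim
    · rw [f1, f2] at hab
      exact (hxy.ne' hab).elim
    · rfl
    · rw [f2] at hab
      exact ((hy _ (hab ▸ f4 b hb1 hb2)).ne rfl).elim
    · rw [f1] at hab
      exact ((hx _ (hab ▸ f4 a ha1 ha2)).ne rfl).elim
    · rw [f2] at hab
      exact ((hy _ (hab ▸ f4 a ha1 ha2)).ne rfl).elim
    · rw [f3 a ha1 ha2, f3 b hb1 hb2] at hab
      simpa using e.injective (Subtype.ext hab)
  · intro v hv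
    rw [f1]
    rcases hcases v with rfl | rfl | ⟨h1, h2⟩
    · exact (hv.ne rfl).elim
    · rwa [f2]
    · exact hx _ (f4 v h1 h2)
  · intro v hv
    rw [f2]
    rcases hcases v with rfl | rfl | ⟨h1, h2⟩
    · rw [f1]
      exact hxy.symm
    · exact (hv.ne rfl).elim
    · exact hy _ (f4 v h1 h2)

open Classical in
/-- If `F` has a single triangle and a small degree, then it is contained in a complete bipartite
graph together with one edge. -/
theorem IsEdgeControlSet.isContained_of_edge [Fintype V] {u₁ u₂ w : V}
    (h : IsEdgeControlSet F {s(u₁, u₂)}) (hw₁ : F.Adj u₁ w) (hw₂ : F.Adj u₂ w)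
    (huniq : ∀ w', F.Adj u₁ w' → F.Adj u₂ w' → w' = w) {x y : α} (hxy : G.Adj x y)
    {A X : Finset α} (hdeg : (F.neighborSet u₁).ncard ≤ A.card + 1)
    (hAx : ∀ a ∈ A, G.Adj x a) (hAy : ∀ a ∈ A, G.Adj y a) (hAX : ∀ a ∈ A, ∀ z ∈ X, G.Adj a z)
    (hX : Fintype.card V + 2 ≤ X.card) : F ⊑ G := by
  have hu₂w : u₂ ≠ w := hw₂.ne
  have hu₁w : u₁ ≠ w := hw₁.ne
  have hu₁u₂ : u₁ ≠ u₂ := h.adj.ne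
  let N : Finset V := Finset.univ.filter fun v => F.Adj u₁ v ∧ v ≠ u₂ ∧ v ≠ w
  have hN : N.card + 2 = (F.neighborSet u₁).ncard := by
    have h1 : F.neighborSet u₁ = ((N ∪ {u₂, w} : Finset V) : Set V) := by
      ext v
      simp only [mem_neighborSet, Finset.coe_union, Finset.coe_insert, Finset.coe_singleton,
        Set.mem_union, Finset.mem_coe, Set.mem_insert_iff, Set.mem_singleton_iff, N,
        Finset.mem_filter, Finset.mem_univ, true_and]
      constructor
      · tauto
      · rintro (h1 | rfl | rfl)
        · exact h1.1
        · exact h.adj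
        · exact hw₁
    rw [h1, Set.ncard_coe_finset, Finset.card_union_of_disjoint, Finset.card_pair hu₂w]
    rw [Finset.disjoint_left]
    intro v hv
    simp only [N, Finset.mem_filter] at hv
    simp [hv.2.2.1, hv.2.2.2]
  obtain ⟨a, ha⟩ : A.Nonempty := by
    rw [← Finset.card_pos]
    omega
  have hAc := Finset.card_erase_add_one ha
  obtain ⟨eA⟩ : Nonempty (N ↪ A.erase a) :=
    Function.Embedding.nonempty_of_card_le (by simp only [Fintype.card_coe]; omega)
  have hXc : Fintype.card V ≤ (X \ {x, y}).card := by
    have h1 := Finset.le_card_sdiff {x, y} X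
    rw [Finset.card_pair hxy.ne] at h1
    omega
  obtain ⟨eX⟩ : Nonempty (V ↪ (X \ {x, y} : Finset α)) :=
    Function.Embedding.nonempty_of_card_le (by simpa only [Fintype.card_coe] using hXc)
  -- The extra edge `xy` receives `u₁w` rather than the control edge. The other neighbours of `u₁`
  -- go to `A`, which has room since `d(u₁) - 2 ≤ A.card - 1`; those of `u₂` go to `X`, since by
  -- uniqueness of `w` they are not adjacent to `u₁`.
  let f : V → α := fun v => if v = u₁ then x else if v = w then y else if v = u₂ then a else
    if hv : v ∈ N then eA ⟨v, hv⟩ else eX v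
  have f1 : f u₁ = x := by simp [f]
  have fw : f w = y := by simp [f, hu₁w.symm]
  have f2 : f u₂ = a := by simp [f, hu₁u₂.symm, hu₂w]
  have hN' : ∀ v ∈ N, F.Adj u₁ v ∧ v ≠ u₂ ∧ v ≠ w := fun v hv => (Finset.mem_filter.1 hv).2
  have fN : ∀ v (hv : v ∈ N), f v = eA ⟨v, hv⟩ := by
    intro v hv
    obtain ⟨h1, h2, h3⟩ := hN' v hv
    simp [f, h1.ne', h2, h3, hv]
  have fX : ∀ v, v ≠ u₁ → v ≠ u₂ → v ≠ w → v ∉ N → f v = eX v := by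
    intro v h1 h2 h3 h4
    simp [f, h1, h2, h3, h4]
  have fNA : ∀ v ∈ N, f v ∈ A ∧ f v ≠ a := by
    intro v hv
    rw [fN v hv]
    have := (eA ⟨v, hv⟩).2
    exact ⟨Finset.mem_of_mem_erase this, Finset.ne_of_mem_erase this⟩
  have fXX : ∀ v, v ≠ u₁ → v ≠ u₂ → v ≠ w → v ∉ N → f v ∈ X ∧ f v ≠ x ∧ f v ≠ y := by
    intro v h1 h2 h3 h4
    rw [fX v h1 h2 h3 h4]
    have := (eX v).2
    simpa only [Finset.mem_sdiff, Finset.mem_insert, Finset.mem_singleton, not_or] using this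
  have hxA : x ∉ A := fun hx => (hAx x hx).ne rfl
  have hyA : y ∉ A := fun hy => (hAy y hy).ne rfl
  have hXA : ∀ z ∈ X, z ∉ A := fun z hz hzA => (hAX z hzA z hz).ne rfl
  have hcases : ∀ v, v = u₁ ∨ v = u₂ ∨ v = w ∨ v ∈ N ∨ (v ≠ u₁ ∧ v ≠ u₂ ∧ v ≠ w ∧ v ∉ N) := by
    intro v
    tauto
  refine h.isContained f ?_ ?_ ?_
  · have hNN : ∀ v ∈ N, ∀ v' ∈ N, f v = f v' → v = v' := by
      intro v hv v' hv' hvv'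
      rw [fN v hv, fN v' hv'] at hvv'
      simpa using eA.injective (Subtype.ext hvv')
    have hXX : ∀ v, v ≠ u₁ → v ≠ u₂ → v ≠ w → v ∉ N → ∀ v', v' ≠ u₁ → v' ≠ u₂ → v' ≠ w →
        v' ∉ N → f v = f v' → v = v' := by
      intro v h1 h2 h3 h4 v' h1' h2' h3' h4' hvv'
      rw [fX v h1 h2 h3 h4, fX v' h1' h2' h3' h4'] at hvv'
      exact eX.injective (Subtype.ext hvv')
    have hxy' := hxy.ne
    have hval : ∀ v, v = u₁ ∧ f v = x ∨ v = u₂ ∧ f v = a ∨ v = w ∧ f v = y ∨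
        v ∈ N ∧ f v ∈ A ∧ f v ≠ a ∨ (v ≠ u₁ ∧ v ≠ u₂ ∧ v ≠ w ∧ v ∉ N) ∧
          f v ∉ A ∧ f v ≠ x ∧ f v ≠ y := by
      intro v
      rcases hcases v with rfl | rfl | rfl | hvN | ⟨h1, h2, h3, h4⟩
      · exact Or.inl ⟨rfl, f1⟩
      · exact Or.inr (Or.inl ⟨rfl, f2⟩)
      · exact Or.inr (Or.inr (Or.inl ⟨rfl, fw⟩))
      · exact Or.inr (Or.inr (Or.inr (Or.inl ⟨hvN, fNA v hvN⟩)))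
      · have := fXX v h1 h2 h3 h4
        exact Or.inr (Or.inr (Or.inr (Or.inr ⟨⟨h1, h2, h3, h4⟩, hXA _ this.1, this.2⟩)))
    intro b c hbc
    rcases hval b with ⟨hb', hb⟩ | ⟨hb', hb⟩ | ⟨hb', hb⟩ | ⟨hb', hb⟩ | ⟨hb', hb⟩ <;>
      rcases hval c with ⟨hc', hc⟩ | ⟨hc', hc⟩ | ⟨hc', hc⟩ | ⟨hc', hc⟩ | ⟨hc', hc⟩ <;>
      first
      | exact hb'.trans hc'.symm
      | exact hNN b hb' c hc' hbc
      | exact hXX b hb'.1 hb'.2.1 hb'.2.2.1 hb'.2.2.2 c hc'.1 hc'.2.1 hc'.2.2.1 hc'.2.2.2 hbc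
      | (exfalso
         rw [hbc] at hb
         clear * - hb hc hxA hyA ha hxy'
         grind)
  · intro v hv
    rw [f1]
    rcases hcases v with rfl | rfl | rfl | hvN | ⟨h1, h2, h3, h4⟩
    · exact (hv.ne rfl).elim
    · rw [f2]
      exact hAx a ha
    · rwa [fw]
    · exact hAx _ (fNA v hvN).1
    · exact (h4 (Finset.mem_filter.2 ⟨Finset.mem_univ _, hv, h2, h3⟩)).elim
  · intro v hv
    rw [f2]
    rcases hcases v with rfl | rfl | rfl | hvN | ⟨h1, h2, h3, h4⟩
    · rw [f1]
      exact (hAx a ha).symm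
    · exact (hv.ne rfl).elim
    · rw [fw]
      exact (hAy a ha).symm
    · exact ((hN' v hvN).2.2 (huniq v (hN' v hvN).1 hv)).elim
    · exact hAX a ha _ (fXX v h1 h2 h3 h4).1

end ControlEdge

/-! ### Extremal graphs and conclusion -/

section Extremal

variable {α : Type*}

open Classical in
theorem adjCount_univ [Fintype α] (G : SimpleGraph α) [Fintype G.edgeSet] :
    adjCount G Finset.univ Finset.univ = 2 * (G.edgeFinset.card : ℤ) := by
  have h1 := G.sum_degrees_eq_twice_card_edges
  have h2 : adjCount G Finset.univ Finset.univ = ∑ v, (G.degree v : ℤ) := by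
    rw [adjCount_eq_sum]
    refine Finset.sum_congr rfl fun v _ => ?_
    rw [adjCount_singleton_left, ← card_neighborFinset_eq_degree, neighborFinset_eq_filter]
  rw [h2]
  have h3 : ((∑ v, G.degree v : ℕ) : ℤ) = ((2 * G.edgeFinset.card : ℕ) : ℤ) := by
    rw [h1]
    congr!
  push_cast at h3
  exact h3

/-- The complete bipartite graph between `S` and its complement, together with the edge `xy`
if `x ≠ y`. -/
def bipartitePlus (S : Finset α) (x y : α) : SimpleGraph α where
  Adj u v := (u ∈ S ∧ v ∉ S) ∨ (v ∈ S ∧ u ∉ S) ∨ (x ≠ y ∧ (u = x ∧ v = y ∨ u = y ∧ v = x))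
  symm := ⟨fun _ _ h => by tauto⟩
  loopless := ⟨fun _ h => by grind⟩

theorem bipartitePlus_adj_of_notMem {S : Finset α} {x y u v : α}
    (h : (bipartitePlus S x y).Adj u v) (hu : u ∉ S) (hv : v ∉ S) :
    x ≠ y ∧ (u = x ∧ v = y ∨ u = y ∧ v = x) := by
  have h' : (u ∈ S ∧ v ∉ S) ∨ (v ∈ S ∧ u ∉ S) ∨ (x ≠ y ∧ (u = x ∧ v = y ∨ u = y ∧ v = x)) := h
  tauto

theorem not_mem_of_bipartitePlus_adj {S : Finset α} {x y u v : α} (hx : x ∉ S) (hy : y ∉ S)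
    (h : (bipartitePlus S x y).Adj u v) (hu : u ∈ S) : v ∉ S := by
  rcases h with h | h | h
  · exact h.2
  · exact (h.2 hu).elim
  · rcases h.2 with ⟨rfl, rfl⟩ | ⟨rfl, rfl⟩
    · exact (hx hu).elim
    · exact (hy hu).elim

open Classical in
/-- The extremal graphs do not contain the linear forest. -/
theorem linearForest_free_bipartitePlus {k : ℕ} {p : Fin k → ℕ} {S : Finset α} {x y : α}
    (hodd : x ≠ y → ∀ i, ¬ Even (p i)) (hS : S.card < ∑ i, p i / 2) :
    (linearForest p).Free (bipartitePlus S x y) := by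
  rintro ⟨f⟩
  have hadj : ∀ (i : Fin k) (s : ℕ) (hs : s + 1 < p i),
      (bipartitePlus S x y).Adj (f ⟨i, ⟨s, by omega⟩⟩) (f ⟨i, ⟨s + 1, hs⟩⟩) :=
    fun i s hs => f.toHom.map_rel ⟨rfl, Or.inl rfl⟩
  have hinj : ∀ (i j : Fin k) (s t : ℕ) (hs : s < p i) (ht : t < p j),
      f ⟨i, ⟨s, hs⟩⟩ = f ⟨j, ⟨t, ht⟩⟩ → i = j ∧ s = t := by
    intro i j s t hs ht h
    have h1 := f.injective h
    obtain rfl : i = j := congrArg Sigma.fst h1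
    simpa using h1
  -- Cut component `i` into disjoint consecutive pairs, each meeting `S`. If a pair misses `S`, it
  -- is mapped to `xy`; then `p i` is odd, and shifting by `o = 1` works, since `xy` cannot be used
  -- twice.
  have hstart : ∀ i, ∃ o, ∀ t < p i / 2, ∃ s, ∃ hs : s < p i, o + 2 * t ≤ s ∧
      s ≤ o + 2 * t + 1 ∧ f ⟨i, ⟨s, hs⟩⟩ ∈ S := by
    intro i
    by_cases h0 : ∀ (t : ℕ) (ht : 2 * t + 1 < p i), f ⟨i, ⟨2 * t, by omega⟩⟩ ∈ S ∨
        f ⟨i, ⟨2 * t + 1, ht⟩⟩ ∈ S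
    · refine ⟨0, fun t ht => ?_⟩
      rcases h0 t (by omega) with h | h
      · exact ⟨2 * t, by omega, by omega, by omega, h⟩
      · exact ⟨2 * t + 1, by omega, by omega, by omega, h⟩
    · push Not at h0
      obtain ⟨t₀, ht₀, h1, h2⟩ := h0
      obtain ⟨hxy, h3⟩ := bipartitePlus_adj_of_notMem (hadj i (2 * t₀) ht₀) h1 h2
      have hpi := Nat.two_mul_div_two_add_one_of_odd (Nat.not_even_iff_odd.1 (hodd hxy i))
      refine ⟨1, fun t ht => ?_⟩
      by_contra! hc
      have h4 := hc (2 * t + 1) (by omega) (by omega) (by omega)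
      have h5 := hc (2 * t + 1 + 1) (by omega) (by omega) (by omega)
      obtain ⟨-, h6⟩ := bipartitePlus_adj_of_notMem (hadj i (2 * t + 1) (by omega)) h4 h5
      rcases h3 with ⟨e1, e2⟩ | ⟨e1, e2⟩ <;> rcases h6 with ⟨e3, e4⟩ | ⟨e3, e4⟩
      · have := (hinj _ _ _ _ _ _ (e1.trans e3.symm)).2
        omega
      · have h7 := (hinj _ _ _ _ _ _ (e1.trans e4.symm)).2
        have h8 := (hinj _ _ _ _ _ _ (e2.trans e3.symm)).2
        omega
      · have h7 := (hinj _ _ _ _ _ _ (e1.trans e4.symm)).2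
        have h8 := (hinj _ _ _ _ _ _ (e2.trans e3.symm)).2
        omega
      · have := (hinj _ _ _ _ _ _ (e1.trans e3.symm)).2
        omega
  choose o ho using hstart
  choose s hs h1 h2 h3 using ho
  let g : (Σ i : Fin k, Fin (p i / 2)) → S := fun z =>
    ⟨f ⟨z.1, ⟨s z.1 z.2 z.2.2, hs z.1 z.2 z.2.2⟩⟩, h3 z.1 z.2 z.2.2⟩
  have hg : Function.Injective g := by
    rintro ⟨i, t⟩ ⟨j, t'⟩ hzz
    obtain ⟨hij, hst⟩ := hinj _ _ _ _ _ _ (congrArg Subtype.val hzz)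
    simp only at hij
    subst hij
    have a1 := h1 i t t.2
    have a2 := h2 i t t.2
    have a3 := h1 i t' t'.2
    have a4 := h2 i t' t'.2
    simp only at hst
    have : t = t' := Fin.ext (by omega)
    rw [this]
  have := Fintype.card_le_of_injective g hg
  simp at this
  omega

variable {V : Type*} {F : SimpleGraph V}

-- With equal ends the extra edge is absent, and membership in `S` pulls back to a proper
-- 2-colouring of `F`.
open Classical in
theorem free_bipartitePlus_self (hχ : 3 ≤ F.chromaticNumber) (S : Finset α) (x : α) :
    F.Free (bipartitePlus S x x) := by
  rintro ⟨f⟩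
  have hcol : F.Colorable (Fintype.card Bool) := by
    refine (SimpleGraph.Coloring.mk (fun v => decide (f v ∈ S)) ?_).colorable
    intro a b hab
    rcases f.toHom.map_rel hab with h | h | h
    · have h1 : f a ∈ S := h.1
      have h2 : f b ∉ S := h.2
      simp [h1, h2]
    · have h1 : f b ∈ S := h.1
      have h2 : f a ∉ S := h.2
      simp [h1, h2]
    · exact (h.1 rfl).elim
  have := hχ.trans hcol.chromaticNumber_le
  rw [Fintype.card_bool] at this
  exact absurd this (by decide)

-- Both `u₁` and `w` land outside `S`, so `u₁w` is mapped to `xy`. Thus `w` is the only neighbour of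
-- `u₁` outside `S`: it is the only possible third vertex of a triangle, and the other neighbours of
-- `u₁` fit into `S`.
open Classical in
theorem triangleCount_eq_one_of_copy {S : Finset α} {x y : α} (hx : x ∉ S) (hy : y ∉ S)
    {u₁ u₂ w : V} (h : IsEdgeControlSet F {s(u₁, u₂)}) (hw₁ : F.Adj u₁ w) (hw₂ : F.Adj u₂ w)
    (f : Copy F (bipartitePlus S x y)) (hu₁ : f u₁ ∉ S) (hu₂ : f u₂ ∈ S) :
    triangleCount F = 1 ∧ (F.neighborSet u₁).ncard ≤ S.card + 1 := by
  have hf : ∀ {a b}, F.Adj a b → (bipartitePlus S x y).Adj (f a) (f b) :=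
    fun hab => f.toHom.map_rel hab
  have hwS : f w ∉ S := not_mem_of_bipartitePlus_adj hx hy (hf hw₂) hu₂
  have huniq : ∀ v, F.Adj u₁ v → f v ∉ S → v = w := by
    intro v hv hvS
    have h1 := bipartitePlus_adj_of_notMem (hf hw₁) hu₁ hwS
    have h2 := bipartitePlus_adj_of_notMem (hf hv) hu₁ hvS
    refine f.injective ?_
    rcases h1.2 with ⟨e1, e2⟩ | ⟨e1, e2⟩ <;> rcases h2.2 with ⟨e3, e4⟩ | ⟨e3, e4⟩
    · exact e4.trans e2.symm
    · exact (h1.1 (e1.symm.trans e3)).elim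
    · exact (h1.1 (e3.symm.trans e1)).elim
    · exact e4.trans e2.symm
  constructor
  · unfold triangleCount
    rw [Set.ncard_eq_one]
    refine ⟨{u₁, u₂, w}, ?_⟩
    ext t
    rw [Set.mem_singleton_iff]
    constructor
    · intro ht
      obtain ⟨w', h1, h2, rfl⟩ := h.eq_of_isNClique_three ht
      rw [huniq w' h1 (not_mem_of_bipartitePlus_adj hx hy (hf h2) hu₂)]
    · rintro rfl
      exact is3Clique_triple_iff.2 ⟨h.adj, hw₁, hw₂⟩
  · have hmaps : ∀ v ∈ F.neighborSet u₁, f v ∈ (insert (f w) S : Finset α) := by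
      intro v hv
      by_cases hvS : f v ∈ S
      · exact Finset.mem_insert_of_mem hvS
      · rw [huniq v hv hvS]
        exact Finset.mem_insert_self _ _
    have h1 := Set.ncard_le_ncard_of_injOn (t := ((insert (f w) S : Finset α) : Set α)) f hmaps
      f.injective.injOn (Finset.finite_toSet _)
    rw [Set.ncard_coe_finset] at h1
    exact h1.trans (Finset.card_insert_le _ _)

-- `S` is independent, so at most one end of the control edge lands in it. If one does, the
-- preceding lemma applies. If none does, the control edge is mapped to `xy`; every other vertex,
-- not being isolated, is adjacent to one of its ends and lands in `S`, so `F` has at most `S.card +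
-- 2` vertices.
open Classical in
theorem free_bipartitePlus [Fintype V] (hχ : 3 ≤ F.chromaticNumber)
    (hβ : edgeControlNumber F = 1) (hF : ∀ v, ¬ F.IsIsolated v) {S : Finset α} {x y : α}
    (hx : x ∉ S) (hy : y ∉ S) (hcard : S.card + 2 < Fintype.card V)
    (ht : triangleCount F = 1 → S.card + 1 < minControlDegree F) :
    F.Free (bipartitePlus S x y) := by
  rintro ⟨f⟩
  obtain ⟨u₁, u₂, h⟩ := exists_control_edge hβ
  obtain ⟨w, hw₁, hw₂⟩ := h.exists_common_neighbour hχ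
  have hf : ∀ {a b}, F.Adj a b → (bipartitePlus S x y).Adj (f a) (f b) :=
    fun hab => f.toHom.map_rel hab
  by_cases hu₂ : f u₂ ∈ S
  · have hu₁ : f u₁ ∉ S := not_mem_of_bipartitePlus_adj hx hy (hf h.adj.symm) hu₂
    obtain ⟨h1, h2⟩ := triangleCount_eq_one_of_copy hx hy h hw₁ hw₂ f hu₁ hu₂
    exact absurd ((ht h1).trans_le (minControlDegree_le h)) (by omega)
  by_cases hu₁ : f u₁ ∈ S
  · obtain ⟨h1, h2⟩ := triangleCount_eq_one_of_copy hx hy h.swap hw₂ hw₁ f hu₂ hu₁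
    exact absurd ((ht h1).trans_le (minControlDegree_le h.swap)) (by omega)
  have h12 := bipartitePlus_adj_of_notMem (hf h.adj) hu₁ hu₂
  have hone : ∀ a v, (a = u₁ ∨ a = u₂) → F.Adj a v → v ≠ u₁ → v ≠ u₂ → f v ∈ S := by
    intro a v ha hav hv1 hv2
    by_contra hvS
    have haS : f a ∉ S := by
      rcases ha with rfl | rfl
      · exact hu₁
      · exact hu₂
    have h3 := bipartitePlus_adj_of_notMem (hf hav) haS hvS
    have hn1 : f v ≠ f u₁ := fun e => hv1 (f.injective e)
    have hn2 : f v ≠ f u₂ := fun e => hv2 (f.injective e)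
    grind
  have hmaps : ∀ v, f v ∈ S ∪ {f u₁, f u₂} := by
    intro v
    by_cases hv1 : v = u₁
    · simp [hv1]
    by_cases hv2 : v = u₂
    · simp [hv2]
    refine Finset.mem_union_left _ ?_
    obtain ⟨z, hz⟩ : ∃ z, F.Adj v z := by
      by_contra! hno
      exact hF v hno
    have hz' : z = u₁ ∨ z = u₂ := by
      have := h.touches hz
      tauto
    exact hone z v hz' hz.symm hv1 hv2
  have h1 := Finset.card_le_card_of_injOn (s := Finset.univ) f (fun v _ => hmaps v)
    f.injective.injOn
  have h2 := Finset.card_union_le S {f u₁, f u₂}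
  have h3 := Finset.card_le_two (a := f u₁) (b := f u₂)
  rw [Finset.card_univ] at h1
  omega

open Classical in
theorem le_adjCount_bipartitePlus [Fintype α] {S : Finset α} {x y : α} (hx : x ∉ S) (hy : y ∉ S) :
    2 * ((S.card : ℤ) * (Fintype.card α - S.card) + if x = y then 0 else 1) ≤
      adjCount (bipartitePlus S x y) Finset.univ Finset.univ := by
  have h1 := adjCount_sdiff_self (bipartitePlus S x y) (Finset.subset_univ S)
  have h2 : adjCount (bipartitePlus S x y) S (Finset.univ \ S)
      = S.card * ((Finset.univ \ S).card : ℤ) :=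
    adjCount_eq_card_mul_card _ fun u hu v hv => Or.inl ⟨hu, (Finset.mem_sdiff.1 hv).2⟩
  have h3 : ((Finset.univ \ S).card : ℤ) = Fintype.card α - S.card := by
    have := Finset.card_sdiff_add_card_eq_card (Finset.subset_univ S)
    rw [Finset.card_univ] at this
    omega
  have h4 := adjCount_nonneg (bipartitePlus S x y) S S
  have h5 : 2 * (if x = y then 0 else 1 : ℤ) ≤
      adjCount (bipartitePlus S x y) (Finset.univ \ S) (Finset.univ \ S) := by
    split_ifs with hxy
    · simpa using adjCount_nonneg _ _ _
    · have hsub : ({x, y} : Finset α) ⊆ Finset.univ \ S := by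
        intro z hz
        rw [Finset.mem_insert, Finset.mem_singleton] at hz
        rcases hz with rfl | rfl <;> simpa
      have h6 := adjCount_sdiff_self (bipartitePlus S x y) hsub
      have h7 := adjCount_nonneg (bipartitePlus S x y) {x, y} ((Finset.univ \ S) \ {x, y})
      have h8 := adjCount_nonneg (bipartitePlus S x y) ((Finset.univ \ S) \ {x, y})
        ((Finset.univ \ S) \ {x, y})
      have h9 := adjCount_union_self (bipartitePlus S x y) (U := {x}) (W := {y})
        (by simpa using hxy)
      have h10 : adjCount (bipartitePlus S x y) {x} {y} = 1 := by
        rw [adjCount_eq_card_mul_card]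
        · simp
        · intro u hu v hv
          rw [Finset.mem_singleton] at hu hv
          exact Or.inr (Or.inr ⟨hxy, Or.inl ⟨hu, hv⟩⟩)
      rw [adjCount_singleton_self, adjCount_singleton_self, h10, ← Finset.insert_eq] at h9
      linarith
  rw [h2, h3] at h1
  linarith

open Classical in
/-- The upper bound, given `ℓ - 1` vertices with many common neighbours. -/
theorem adjCount_univ_le [Fintype V] (hχ : 3 ≤ F.chromaticNumber)
    (hβ : edgeControlNumber F = 1) {k : ℕ} (hk : 2 ≤ k) {p : Fin k → ℕ} (hp : ∀ i, 3 ≤ p i)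
    (hp' : ∃ i, p i ≠ 3) [Fintype α] {G : SimpleGraph α} (hH : (linearForest p).Free G)
    (hF : F.Free G) {A X : Finset α} (hA : A.card + 1 = ∑ i, p i / 2)
    (hAX : ∀ a ∈ A, ∀ x ∈ X, G.Adj a x) (hX : k + 3 * A.card + 5 + Fintype.card V ≤ X.card) :
    adjCount G Finset.univ Finset.univ ≤
      2 * ((A.card : ℤ) * (Fintype.card α - A.card) + correction F p) := by
  obtain ⟨u₁, u₂, h⟩ := exists_control_edge hβ
  have hAA : adjCount G A A = 0 := by
    refine adjCount_eq_zero G fun a ha b hb hab => hF ?_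
    exact h.isContained_of_book hab (hAX a ha) (hAX b hb) (by omega)
  have hsplit := adjCount_sdiff_self G (Finset.subset_univ A)
  have hdisj : Disjoint (Finset.univ \ A) A := Finset.sdiff_disjoint
  have hcard : ((Finset.univ \ A).card : ℤ) = Fintype.card α - A.card := by
    have := Finset.card_sdiff_add_card_eq_card (Finset.subset_univ A)
    rw [Finset.card_univ] at this
    omega
  rw [hAA, adjCount_comm G A] at hsplit
  rw [← hcard]
  unfold correction
  split_ifs with hR
  · by_contra! hlt
    obtain ⟨hodd, x, hx, y, hy, hxy, hxA, hyA⟩ := exists_edge_of_adjCount hk hp hp' hH hA hAX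
      (by omega) _ hdisj (by push_cast at hlt; linarith)
    -- Each clause rules out the edge `xy` joined to `A`: by parity; because `xy` with the `ℓ - 1`
    -- vertices of `A` is a book on `ℓ + 1` vertices; or because `F` embeds using `xy` as its only
    -- edge within the large side.
    rcases hR with ⟨i, hi⟩ | hV | ⟨ht, hf⟩
    · exact hodd i hi
    · rw [Nat.card_eq_fintype_card] at hV
      exact hF (h.isContained_of_book hxy hxA hyA (by omega))
    · obtain ⟨v₁, v₂, h', hdeg⟩ := exists_control_edge_of_minControlDegree_le hβ hf
      obtain ⟨w, hw₁, hw₂⟩ := h'.exists_common_neighbour hχ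
      exact hF (h'.isContained_of_edge hw₁ hw₂
        (fun w' h1 h2 => h'.unique_of_triangleCount ht hw₁ hw₂ h1 h2) hxy (by omega) hxA hyA hAX
        (by omega))
  · have := adjCount_compl_le hk hp hp' hH hA hAX (by omega) _ hdisj
    push_cast
    linarith

open Classical in
/-- The lower bound. -/
theorem exists_free_graph [Fintype V] (hχ : 3 ≤ F.chromaticNumber)
    (hβ : edgeControlNumber F = 1) (hF : ∀ v, ¬ F.IsIsolated v) {k : ℕ} {p : Fin k → ℕ} {a : ℕ}
    (ha : a + 1 = ∑ i, p i / 2) [Fintype α] (hα : a + 2 ≤ Fintype.card α) :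
    ∃ G : SimpleGraph α, (linearForest p).Free G ∧ F.Free G ∧
      2 * ((a : ℤ) * (Fintype.card α - a) + correction F p) ≤
        adjCount G Finset.univ Finset.univ := by
  obtain ⟨S, -, hS⟩ := Finset.exists_subset_card_eq
    (show a ≤ (Finset.univ : Finset α).card by rw [Finset.card_univ]; omega)
  obtain ⟨x, hx, y, hy, hxy⟩ := Finset.one_lt_card.1 (show 1 < (Finset.univ \ S).card by
    have := Finset.card_sdiff_add_card_eq_card (Finset.subset_univ S)
    rw [Finset.card_univ] at this
    omega)
  replace hx := (Finset.mem_sdiff.1 hx).2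
  replace hy := (Finset.mem_sdiff.1 hy).2
  unfold correction
  split_ifs with hR
  · refine ⟨bipartitePlus S x x, linearForest_free_bipartitePlus (fun h => (h rfl).elim)
      (by omega), free_bipartitePlus_self hχ S x, ?_⟩
    have := le_adjCount_bipartitePlus hx hx
    rw [if_pos rfl, hS] at this
    exact_mod_cast this
  · simp only [PropertyR, not_or, not_exists, not_and, not_le, Nat.card_eq_fintype_card] at hR
    refine ⟨bipartitePlus S x y, linearForest_free_bipartitePlus (fun _ => hR.1)
      (by omega), free_bipartitePlus hχ hβ hF hx hy (by omega) (fun h => ?_), ?_⟩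
    · have := hR.2.2 h
      omega
    · have := le_adjCount_bipartitePlus hx hy
      rw [if_neg hxy, hS] at this
      exact_mod_cast this

open Classical in
theorem turanNumber_eq {W V : Type*} {n : ℕ} {H : SimpleGraph W} {F : SimpleGraph V} {m : ℤ}
    (hle : ∀ G : SimpleGraph (Fin n), H.Free G → F.Free G →
      adjCount G Finset.univ Finset.univ ≤ 2 * m)
    {G : SimpleGraph (Fin n)} (hH : H.Free G) (hF : F.Free G)
    (hG : 2 * m ≤ adjCount G Finset.univ Finset.univ) : (turanNumber n H F : ℤ) = m := by
  have hgreatest : IsGreatest {m : ℕ | ∃ G : SimpleGraph (Fin n), H.Free G ∧ F.Free G ∧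
      G.edgeFinset.card = m} G.edgeFinset.card := by
    refine ⟨⟨G, hH, hF, rfl⟩, ?_⟩
    rintro _ ⟨G', hH', hF', rfl⟩
    have h1 := hle G' hH' hF'
    rw [adjCount_univ] at h1 hG
    omega
  have heq : turanNumber n H F = G.edgeFinset.card := hgreatest.csSup_eq
  have h1 := hle G hH hF
  rw [adjCount_univ] at h1 hG
  rw [heq]
  omega

theorem turanNumber_linearForest [Finite V] (hχ : 3 ≤ F.chromaticNumber)
    (hβ : edgeControlNumber F = 1) (hF : ∀ v : V, ¬ F.IsIsolated v) {k : ℕ} (hk : 2 ≤ k)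
    {p : Fin k → ℕ} (hp : ∀ i, 3 ≤ p i) (hp' : ∃ i, p i ≠ 3) {a : ℕ}
    (ha : a + 1 = ∑ i, p i / 2) :
    ∃ N : ℕ, ∀ n ≥ N,
      (turanNumber n (linearForest p) F : ℤ) = (a : ℤ) * (n - a) + correction F p := by
  have := Fintype.ofFinite V
  -- The slack `2 * a * a` is the gap between `2 * a * n` and twice the bipartite count `a * (n -
  -- a)`.
  obtain ⟨N, hN⟩ := exists_common_neighbours hk hp (k + 3 * a + 5 + Fintype.card V) (2 * a * a)
  refine ⟨N + a + 2, fun n hn => ?_⟩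
  obtain ⟨G, hH, hFG, hG⟩ := exists_free_graph (α := Fin n) hχ hβ hF ha
    (by rw [Fintype.card_fin]; omega)
  rw [Fintype.card_fin] at hG
  refine turanNumber_eq (fun G hH hFG => ?_) hH hFG hG
  by_contra! hlt
  have hcorr : (0 : ℤ) ≤ correction F p := by positivity
  obtain ⟨A, X, hA, hX, hAX⟩ := hN (Fin n) G (by rw [Fintype.card_fin]; omega) hH (by
    rw [← ha, Fintype.card_fin]
    push_cast
    linarith)
  have hAa : A.card = a := by omega
  have h1 := adjCount_univ_le hχ hβ hk hp hp' hH hFG (A := A) (X := X) (by omega) hAX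
    (by rw [hAa]; exact hX)
  rw [hAa, Fintype.card_fin] at h1
  exact hlt.not_ge h1

end Extremal

end TuranLinearForest

theorem mainTheorem2 {V : Type*} [Finite V] (F : SimpleGraph V)
    (hχ : 3 ≤ F.chromaticNumber)
    (hβ : TuranLinearForest.edgeControlNumber F = 1)
    (hF : ∀ v : V, ¬ F.IsIsolated v)
    (k : ℕ) (hk : 2 ≤ k) (p : Fin k → ℕ) (hp : ∀ i, 3 ≤ p i) (hp' : ∃ i, p i ≠ 3)
    (ℓ : ℕ) (hℓ : ℓ = ∑ i, p i / 2) :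
    ∃ N : ℕ, ∀ n ≥ N,
      (TuranLinearForest.turanNumber n (TuranLinearForest.linearForest p) F : ℤ) =
        ((ℓ : ℤ) - 1) * ((n : ℤ) - ℓ + 1) + TuranLinearForest.correction F p := by
  obtain ⟨a, ha⟩ : ∃ a, a + 1 = ℓ := by
    have := TuranLinearForest.half_lt_sum hk hp ⟨0, by omega⟩
    exact ⟨ℓ - 1, by omega⟩
  obtain ⟨N, hN⟩ :=
    TuranLinearForest.turanNumber_linearForest hχ hβ hF hk hp hp' (ha.trans hℓ)
  refine ⟨N, fun n hn => ?_⟩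
  rw [hN n hn, ← ha]
  push_cast
  ring
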